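/- **Theorem (IDS regret bound).** Let $N\ge 1$. The beta-Bernoulli bandit alignment problem has environment actions $\mathcal{A}_e=\{1,\dots,N\}$, human queries $\mathcal{A}_h=\{\bar 1,\dots,\bar N\}$, action set $\mathcal{A}=\mathcal{A}_e\cup\mathcal{A}_h$ (so $|\mathcal{A}|=2N$) and observations $\{0,1\}$. The unknown parameters $\phi_1,\dots,\phi_N,\theta_{\bar 1},\dots,\theta_{\bar N}$ are independent with law $\mathrm{beta}(1,1)$. At each time $t=0,1,2,\dots$ an agent $\pi$ draws an action $A_t\sim\pi(\cdot\mid H_t)$, where $H_t=(A_0,O_1,\dots,A_{t-1},O_t)$ is the history and $\pi(\cdot\mid h)$ is a probability mass function on $\mathcal{A}$ for each history $h$; given $(\phi,\theta)$, $H_t$ and $A_t=a$, the observation $O_{t+1}$ is Bernoulli$(\phi_a)$ if $a\in\mathcal{A}_e$ and Bernoulli$(\theta_a)$ if $a\in\mathcal{A}_h$. The reward is $R_{t+1}=\mathcal{R}(A_t,O_{t+1},\theta)$, with $\mathcal{R}(a,o,\theta)=-1$ for $a\in\mathcal{A}_h$ and $\mathcal{R}(a,o,\theta)=o\,\theta_{\bar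 a}+(1-o)(1-\theta_{\bar a})$ for $a\in\mathcal{A}_e$. Let $$R^*=\max_{a\in\mathcal{A}}\mathbb{E}[\mathcal{R}(A_t,O_{t+1},\theta)\mid\phi,\theta,A_t=a],\qquad \Re(\pi,T)=\sum_{t=0}^{T-1}\mathbb{E}_\pi[R^*-R_{t+1}].$$ An information-directed sampling agent $\pi_{\rm ids}$ is an agent such that, for every $t$ and every history $h$ of length $t$ that has positive probability under $\pi_{\rm ids}$, the probability mass function $\pi_{\rm ids}(\cdot\mid h)$ minimizes, over all probability mass functions $q$ on $\mathcal{A}$, the conditional information ratio $$\frac{\mathbb{E}_{A_t\sim q}[R^*-R_{t+1}\mid H_t=h]^2}{\mathbb{I}_{A_t\sim q}(\theta,\phi;A_t,O_{t+1}\mid H_t=h)},$$ where $\mathbb{I}$ is mutual information in nats. Then every information-directed sampling agent satisfies, for every integer $T\ge 0$, $$\Re(\pi_{\rm ids},T)\le\sqrt{33\ln(4T)}\,|\mathcal{A}|^{3/4}\,T^{3/4},$$ where the right-hand side is read as $0$ for $T=0$. Moreover, the bound $B(m,T)=\sqrt{33\ln(4T)}\,m^{3/4}T^{3/4}$ is sublinear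 in each of its arguments: for each fixed $m$, $B(m,T)=o(T)$ as $T\to\infty$, and for each fixed $T$, $B(m,T)=o(m)$ as $m\to\infty$. -/

import Mathlib

open MeasureTheory ProbabilityTheory Asymptotics

open scoped ENNReal

noncomputable section

namespace BanditAlignment

/-- The action set: `Sum.inl i` is the environment action `i` (pulling arm `i`), and `Sum.inr i`
is the query to the human about arm `i`.  Hence `|A| = 2 N`. -/
abbrev Act (N : ℕ) : Type := Fin N ⊕ Fin N

/-- Every set of actions is measurable. -/
instance instDiscreteMeasurableSpaceAct (N : ℕ) : DiscreteMeasurableSpace (Act N) :=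
  ⟨fun _ => measurableSet_sum_iff.2 ⟨MeasurableSet.of_discrete, MeasurableSet.of_discrete⟩⟩

/-- The unknown parameters `(φ, θ)`: `φ i` is the outcome probability of arm `i`, and `θ i` is the
preference of the human for arm `i`. -/
abbrev Params (N : ℕ) : Type := (Fin N → ℝ) × (Fin N → ℝ)

/-- Histories `(A_0, O_1, A_1, O_2, …, A_{t-1}, O_t)` of length `t`; the observation `true` stands
for `1` and `false` for `0`. -/
abbrev Hist (N t : ℕ) : Type := Fin t → Act N × Bool

/-- An agent maps every history to a probability mass function on the actions. -/
abbrev Agent (N : ℕ) : Type := (t : ℕ) → Hist N t → PMF (Act N)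

/-- The prior: all coordinates of `φ` and `θ` are independent with law beta(1,1). -/
def prior (N : ℕ) : Measure (Params N) :=
  (Measure.pi fun _ => betaMeasure 1 1).prod (Measure.pi fun _ => betaMeasure 1 1)

/-- The success probability of the observation that follows an action: `φ i` if arm `i` is pulled,
`θ i` if the human is queried about arm `i`. -/
def successProb {N : ℕ} (x : Params N) : Act N → ℝ
  | Sum.inl i => x.1 i
  | Sum.inr i => x.2 i

/-- The Bernoulli probability of the observation `o` after action `a`, given the parameters
(the prior gives full mass to parameters in `[0,1]`). -/
def obsProb {N : ℕ} (x : Params N) (a : Act N) (o : Bool) : ℝ≥0∞ :=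
  if o then ENNReal.ofReal (successProb x a) else ENNReal.ofReal (1 - successProb x a)

/-- The reward `R(a, o, θ)`: `-1` for a query, and `o θ_a + (1 - o) (1 - θ_a)` for an arm. -/
def reward {N : ℕ} (a : Act N) (o : Bool) (θ : Fin N → ℝ) : ℝ :=
  match a with
  | Sum.inl i => if o then θ i else 1 - θ i
  | Sum.inr _ => -1

/-- The mean reward of an action given the parameters, `E[R(A_t, O_{t+1}, θ) | φ, θ, A_t = a]`. -/
def meanReward {N : ℕ} (x : Params N) (a : Act N) : ℝ :=
  ∑ o : Bool, (obsProb x a o).toReal * reward a o x.2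

/-- The optimal mean reward `R^* = max_a E[R(A_t, O_{t+1}, θ) | φ, θ, A_t = a]`. -/
def optReward {N : ℕ} (x : Params N) : ℝ :=
  ⨆ a : Act N, meanReward x a

/-- The probability, given the parameters, of an action drawn from `q` together with the
observation that follows it. -/
def stepProb {N : ℕ} (q : PMF (Act N)) (x : Params N) (y : Act N × Bool) : ℝ≥0∞ :=
  q y.1 * obsProb x y.1 y.2

/-- The probability of a history when the agent `π` acts, given the parameters. -/
def histProb {N : ℕ} (π : Agent N) (x : Params N) : (t : ℕ) → Hist N t → ℝ≥0∞
  | 0, _ => 1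
  | t + 1, h => histProb π x t (Fin.init h) * stepProb (π t (Fin.init h)) x (h (Fin.last t))

/-- The joint law of the parameters `(φ, θ)` and the history `H_t` when the agent `π` acts. -/
def jointLaw {N : ℕ} (π : Agent N) (t : ℕ) : Measure (Params N × Hist N t) :=
  ((prior N).prod Measure.count).withDensity fun p => histProb π p.1 t p.2

/-- The law of the history `H_t` when the agent `π` acts. -/
def histLaw {N : ℕ} (π : Agent N) (t : ℕ) : Measure (Hist N t) :=
  (jointLaw π t).snd

/-- The regret `∑_{t < T} E_π[R^* - R_{t+1}]`; the action `A_t` and the observation `O_{t+1}` are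
the last entry of the history `H_{t+1}`. -/
def regret {N : ℕ} (π : Agent N) (T : ℕ) : ℝ :=
  ∑ t ∈ Finset.range T,
    ∫ p, (optReward p.1 - reward (p.2 (Fin.last t)).1 (p.2 (Fin.last t)).2 p.1.2)
      ∂(jointLaw π (t + 1))

/-- The conditional law of the parameters given the event `H_t = h`, for the agent `π`. -/
def posterior {N : ℕ} (π : Agent N) {t : ℕ} (h : Hist N t) : Measure (Params N) :=
  (cond (jointLaw π t) (Prod.snd ⁻¹' {h})).fst

/-- The joint law of `((φ, θ), (A_t, O_{t+1}))` when the parameters have law `μ` and the action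
`A_t` is drawn from `q` independently of them. -/
def stepLaw {N : ℕ} (μ : Measure (Params N)) (q : PMF (Act N)) :
    Measure (Params N × (Act N × Bool)) :=
  (μ.prod Measure.count).withDensity fun p => stepProb q p.1 p.2

/-- The mutual information (in nats) of a pair with joint law `ρ`: the Kullback-Leibler divergence
of `ρ` from the product of its marginals. -/
def mutualInfo {α β : Type*} [MeasurableSpace α] [MeasurableSpace β] (ρ : Measure (α × β)) :
    ℝ≥0∞ :=
  InformationTheory.klDiv ρ (ρ.fst.prod ρ.snd)

/-- The conditional information ratio given `H_t = h`, when the history was generated by `π` and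
the next action is drawn from `q`:
`E_q[R^* - R_{t+1} | H_t = h] ^ 2 / I(φ, θ; A_t, O_{t+1} | H_t = h)`. -/
def infoRatio {N : ℕ} (π : Agent N) {t : ℕ} (h : Hist N t) (q : PMF (Act N)) : ℝ≥0∞ :=
  ENNReal.ofReal
      ((∫ p, (optReward p.1 - reward p.2.1 p.2.2 p.1.2) ∂(stepLaw (posterior π h) q)) ^ 2) /
    mutualInfo (stepLaw (posterior π h) q)

/-- `π` is an information-directed sampling agent: at every history of positive probability, the
distribution of its next action minimizes the conditional information ratio over all probability
mass functions on the actions (ties may be broken in any way). -/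
def IsIDS {N : ℕ} (π : Agent N) : Prop :=
  ∀ (t : ℕ) (h : Hist N t), histLaw π t {h} ≠ 0 →
    ∀ q : PMF (Act N), infoRatio π h (π t h) ≤ infoRatio π h q

end BanditAlignment

end

noncomputable section

namespace BanditAlignment

open InformationTheory

/-! At every history of positive probability the cube of the expected one-step regret is at most
`128 * N` times the information gained in that step, while `T` steps yield only order `N log T`
nats. Convexity then turns these two facts into a regret bound.

For the one-step inequality (`cube_expRegret_le`), IDS is compared with a competitor. Choose an arm
with its posterior probability of being optimal and let `D` be the regret of pulling it. By
Cauchy-Schwarz, `D ^ 2` is at most `2 * N` times the average variance `V` of the two parameters of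
the chosen arm (`exists_thompson_weights`). Pulling the arm only informs about `φ`, so the
competitor asks the human about that arm with probability `D / 2` and pulls it otherwise. Queries
cost at most 2, so its regret is at most `2 * D`; a Hellinger bound makes its information at least
`D * V / 4`, hence at least `D ^ 3 / (8 * N)` (`exists_informative_weights`). Minimality of the
ratio along the segment from IDS to the competitor gives both a comparison of ratios and, to first
order, a regret at most twice the competitor's; multiplying the two yields the cubic bound
(`cube_le_of_ratio_minimal`).

For the information budget, conjugacy makes each success probability beta distributed a posteriori.
With mean `m` and `n` past observations its variance is `m (1 - m) / (n + 3)`, and a chi-square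
bound limits the next gain to `1 / (n + 3)` (`toReal_gain_posterior_le`). Along any history these
terms form harmonic sums, one per action (`sum_info_le`).

Finally `d ^ 3 ≤ X` is replaced by its tangent bound `d ≤ X / (3 c ^ 2) + 2 c / 3`, which is linear
and can be averaged over histories and summed over time. Optimizing `c` would give order `(N T) ^
(2/3) (log T) ^ (1/3)`; a cruder `c` suffices here. -/

/-! ### Chi-square and Hellinger estimates for the Kullback-Leibler integrand. -/

lemma klFun_le_sq_sub_one {t : ℝ} (ht : 0 ≤ t) : klFun t ≤ (t - 1) ^ 2 := by
  rcases ht.eq_or_lt with rfl | ht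
  · simp [klFun_apply]
  · have h := mul_le_mul_of_nonneg_left (Real.log_le_sub_one_of_pos ht) ht.le
    rw [klFun_apply]
    nlinarith

/-- With `s = √t`, this is `log t = 2 log s ≥ 2 (1 - 1 / s)` multiplied by `s ^ 2`. -/
lemma sq_sqrt_sub_one_le_klFun {t : ℝ} (ht : 0 ≤ t) : (√t - 1) ^ 2 ≤ klFun t := by
  rcases ht.eq_or_lt with rfl | ht
  · simp [klFun_apply]
  · obtain ⟨s, hs, rfl⟩ : ∃ s : ℝ, 0 < s ∧ t = s ^ 2 :=
      ⟨√t, Real.sqrt_pos.2 ht, (Real.sq_sqrt ht.le).symm⟩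
    rw [Real.sqrt_sq hs.le, klFun_apply, Real.log_pow]
    have h := Real.one_sub_inv_le_log_of_pos hs
    have h2 := mul_le_mul_of_nonneg_left h (by positivity : 0 ≤ 2 * s ^ 2)
    have h3 : 2 * s ^ 2 * (1 - s⁻¹) = 2 * s ^ 2 - 2 * s := by field_simp
    push_cast
    nlinarith

lemma mul_klFun_div_le {p m : ℝ} (hp : 0 ≤ p) (hm : 0 < m) :
    m * klFun (p / m) ≤ (p - m) ^ 2 / m := by
  have h := mul_le_mul_of_nonneg_left (klFun_le_sq_sub_one (div_nonneg hp hm.le)) hm.le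
  have h2 : m * (p / m - 1) ^ 2 = (p - m) ^ 2 / m := by field_simp
  linarith

/-- The Hellinger term `(√p - √m) ^ 2` controls `(p - m) ^ 2` because `√p + √m ≤ 2`. Unlike the
chi-square upper bound, this has a constant independent of `m`. -/
lemma le_mul_klFun_div {p m : ℝ} (hp : 0 ≤ p) (hp1 : p ≤ 1) (hm : 0 < m) (hm1 : m ≤ 1) :
    (p - m) ^ 2 / 4 ≤ m * klFun (p / m) := by
  have h := mul_le_mul_of_nonneg_left (sq_sqrt_sub_one_le_klFun (div_nonneg hp hm.le)) hm.le
  have e : m * (√(p / m) - 1) ^ 2 = (√p - √m) ^ 2 := by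
    rw [Real.sqrt_div hp]
    have h1 : 0 < √m := Real.sqrt_pos.2 hm
    nth_rewrite 1 [← Real.sq_sqrt hm.le]
    field_simp
  have e2 : (p - m) ^ 2 = (√p - √m) ^ 2 * (√p + √m) ^ 2 := by
    rw [← mul_pow]
    nth_rewrite 1 [← Real.sq_sqrt hp, ← Real.sq_sqrt hm.le]
    ring
  have h1 : √p ≤ 1 := by simpa using Real.sqrt_le_sqrt hp1
  have h2 : √m ≤ 1 := by simpa using Real.sqrt_le_sqrt hm1
  have h3 : (√p + √m) ^ 2 ≤ 4 := by
    nlinarith [Real.sqrt_nonneg p, Real.sqrt_nonneg m]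
  rw [e] at h
  have h4 := mul_le_mul_of_nonneg_left h3 (sq_nonneg (√p - √m))
  linarith

/-! ### Mutual information between a parameter and a finite observation. -/

section Generic

variable {Ω Y : Type*} [MeasurableSpace Ω] [MeasurableSpace Y] [MeasurableSingletonClass Y]
  [Fintype Y]

lemma lintegral_prod_count (μ : Measure Ω) [SFinite μ] {F : Ω × Y → ℝ≥0∞} (hF : Measurable F) :
    ∫⁻ z, F z ∂(μ.prod Measure.count) = ∑ y, ∫⁻ x, F (x, y) ∂μ := by
  rw [lintegral_prod_symm _ hF.aemeasurable, lintegral_count, tsum_fintype]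

lemma fst_withDensity_prod_count (μ : Measure Ω) [SFinite μ] {f : Ω × Y → ℝ≥0∞}
    (hf : Measurable f) :
    ((μ.prod Measure.count).withDensity f).fst = μ.withDensity fun x => ∑ y, f (x, y) := by
  ext s hs
  rw [Measure.fst_apply hs, withDensity_apply _ (measurable_fst hs), withDensity_apply _ hs,
    ← lintegral_indicator (measurable_fst hs), lintegral_prod_count _
      (hf.indicator (measurable_fst hs)), lintegral_finsetSum _ (by fun_prop)]
  refine Finset.sum_congr rfl fun y _ => ?_
  rw [← lintegral_indicator hs]
  rfl

lemma snd_withDensity_prod_count (μ : Measure Ω) [SFinite μ] {f : Ω × Y → ℝ≥0∞}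
    (hf : Measurable f) :
    ((μ.prod Measure.count).withDensity f).snd =
      Measure.count.withDensity fun y => ∫⁻ x, f (x, y) ∂μ := by
  ext s hs
  rw [Measure.snd_apply hs, withDensity_apply _ (measurable_snd hs), withDensity_apply _ hs,
    ← lintegral_indicator (measurable_snd hs), lintegral_prod_count _
      (hf.indicator (measurable_snd hs)), ← lintegral_indicator hs, lintegral_count, tsum_fintype]
  refine Finset.sum_congr rfl fun y _ => ?_
  by_cases hy : y ∈ s <;> simp [hy, Set.indicator]

/-- The mutual information of a parameter with law `μ` and an observation in a finite type with
conditional probability mass function `f (x, ·)`. -/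
theorem mutualInfo_withDensity_prod_count (μ : Measure Ω) [IsProbabilityMeasure μ]
    {f : Ω × Y → ℝ≥0∞} (hf : Measurable f) (hsum : ∀ᵐ x ∂μ, ∑ y, f (x, y) = 1) :
    mutualInfo ((μ.prod Measure.count).withDensity f) =
      ∑ y, ∫⁻ x, (∫⁻ x', f (x', y) ∂μ) *
        ENNReal.ofReal (klFun (f (x, y) / ∫⁻ x', f (x', y) ∂μ).toReal) ∂μ := by
  set M : Y → ℝ≥0∞ := fun y => ∫⁻ x', f (x', y) ∂μ with hM
  have hMm : Measurable M := hf.lintegral_prod_left'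
  have hMs : ∑ y, M y = 1 := by
    rw [← lintegral_finsetSum _ (by fun_prop), lintegral_congr_ae hsum]
    simp
  have hMt : ∀ y, M y ≠ ∞ := fun y => by
    have : M y ≤ 1 := hMs ▸ Finset.single_le_sum (fun _ _ => zero_le) (Finset.mem_univ y)
    exact (this.trans_lt ENNReal.one_lt_top).ne
  have hfst : ((μ.prod Measure.count).withDensity f).fst = μ := by
    rw [fst_withDensity_prod_count μ hf, withDensity_congr_ae hsum]
    simp
  have hsnd := snd_withDensity_prod_count μ hf
  have hprod : μ.prod (Measure.count.withDensity M) =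
      (μ.prod Measure.count).withDensity fun z => M z.2 := prod_withDensity_right hMm
  have hfin : IsFiniteMeasure ((μ.prod Measure.count).withDensity f) := by
    constructor
    rw [← Measure.fst_univ, hfst]
    simp
  have hfin' : IsFiniteMeasure (μ.prod (Measure.count.withDensity M)) := by
    rw [← hsnd]; infer_instance
  set ν := μ.prod (Measure.count.withDensity M) with hν
  have hg : Measurable fun z : Ω × Y => f z / M z.2 := by fun_prop
  have hρ : (μ.prod Measure.count).withDensity f = ν.withDensity fun z => f z / M z.2 := by
    rw [hprod, ← withDensity_mul _ (by fun_prop) hg]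
    refine withDensity_congr_ae ?_
    -- An outcome of marginal mass zero has likelihood zero for almost every parameter. Hence the
    -- joint law is absolutely continuous with respect to the product of its marginals, and the
    -- convention `0 / 0 = 0` is harmless.
    have key : ∀ᵐ x ∂μ, ∀ y, M y = 0 → f (x, y) = 0 := by
      rw [ae_all_iff]
      intro y
      by_cases h : M y = 0
      · filter_upwards [(lintegral_eq_zero_iff (by fun_prop)).1 h] with x hx _ using hx
      · exact ae_of_all _ fun _ h' => absurd h' h
    have hset : MeasurableSet {z : Ω × Y | M z.2 = 0 → f z = 0} := by
      have h1 : MeasurableSet {z : Ω × Y | M z.2 = 0} :=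
        (hMm.comp measurable_snd) (measurableSet_singleton 0)
      have h2 : MeasurableSet {z : Ω × Y | f z = 0} := hf (measurableSet_singleton 0)
      exact h1.imp h2
    have key2 : ∀ᵐ z ∂(μ.prod Measure.count), M z.2 = 0 → f z = 0 := by
      rw [Measure.ae_prod_iff_ae_ae hset]
      filter_upwards [key] with x hx
      exact ae_of_all _ hx
    filter_upwards [key2] with z hz
    simp only [Pi.mul_apply]
    by_cases h : M z.2 = 0
    · simp [h, hz h]
    · rw [ENNReal.mul_div_cancel h (hMt _)]
  have hfin'' : IsFiniteMeasure (ν.withDensity fun z => f z / M z.2) := hρ ▸ hfin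
  unfold mutualInfo
  rw [hfst, hsnd, ← hν, hρ, klDiv_eq_lintegral_klFun_of_ac (withDensity_absolutelyContinuous _ _)]
  have h1 := Measure.rnDeriv_withDensity ν hg
  rw [lintegral_congr_ae (g := fun z => ENNReal.ofReal (klFun (f z / M z.2).toReal))
    (by filter_upwards [h1] with z hz; rw [hz]), hprod,
    lintegral_withDensity_eq_lintegral_mul _ (by fun_prop) (by fun_prop),
    lintegral_prod_count _ (by fun_prop)]
  rfl

lemma integral_withDensity_prod_count (μ : Measure Ω) [SFinite μ] {f : Ω × Y → ℝ≥0∞}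
    (hf : Measurable f) (hft : ∀ z, f z ≠ ∞) {F : Ω × Y → ℝ}
    (hint : ∀ y, Integrable (fun x => (f (x, y)).toReal * F (x, y)) μ) (hF : Measurable F) :
    ∫ z, F z ∂((μ.prod Measure.count).withDensity f) =
      ∑ y, ∫ x, (f (x, y)).toReal * F (x, y) ∂μ := by
  rw [integral_withDensity_eq_integral_toReal_smul hf (ae_of_all _ fun z => (hft z).lt_top)]
  simp only [smul_eq_mul]
  have hI : Integrable (fun z : Ω × Y => (f z).toReal * F z) (μ.prod Measure.count) := by
    refine ⟨by fun_prop, ?_⟩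
    rw [hasFiniteIntegral_iff_enorm, lintegral_prod_count _ (by fun_prop)]
    exact ENNReal.sum_lt_top.2 fun y _ => (hint y).2
  rw [integral_prod_symm _ hI, integral_count]

end Generic

variable {N : ℕ}

/-! ### Measurability and elementary bounds for the bandit model. -/

@[fun_prop]
lemma measurable_successProb (a : Act N) : Measurable fun x : Params N => successProb x a := by
  cases a <;> simp only [successProb] <;> fun_prop

@[fun_prop]
lemma measurable_obsProb (a : Act N) (o : Bool) : Measurable fun x : Params N => obsProb x a o := by
  unfold obsProb
  cases o <;> simp <;> fun_prop

@[fun_prop]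
lemma measurable_meanReward (a : Act N) : Measurable fun x : Params N => meanReward x a := by
  unfold meanReward reward
  cases a <;> simp <;> fun_prop

@[fun_prop]
lemma measurable_optReward : Measurable fun x : Params N => optReward x :=
  Measurable.iSup fun a => measurable_meanReward a

@[fun_prop]
lemma measurable_stepProb (q : PMF (Act N)) :
    Measurable fun z : Params N × (Act N × Bool) => stepProb q z.1 z.2 :=
  measurable_from_prod_countable_left fun y => by
    simp only [stepProb]
    exact (measurable_obsProb y.1 y.2).const_mul _

lemma measurable_reward :
    Measurable fun z : Params N × (Act N × Bool) => reward z.2.1 z.2.2 z.1.2 :=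
  measurable_from_prod_countable_left fun y => by
    obtain ⟨a | a, o⟩ := y <;> cases o <;> simp [reward] <;> fun_prop

lemma obsProb_ne_top (x : Params N) (a : Act N) (o : Bool) : obsProb x a o ≠ ∞ := by
  unfold obsProb; split_ifs <;> simp

lemma stepProb_ne_top (q : PMF (Act N)) (x : Params N) (y : Act N × Bool) :
    stepProb q x y ≠ ∞ :=
  ENNReal.mul_ne_top (q.apply_ne_top _) (obsProb_ne_top _ _ _)

/-- All outcome probabilities and preferences lie in the unit interval. -/
def IsUnitParams (x : Params N) : Prop := ∀ a, successProb x a ∈ Set.Icc (0 : ℝ) 1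

lemma sum_obsProb {x : Params N} (hx : IsUnitParams x) (a : Act N) :
    ∑ o, obsProb x a o = 1 := by
  obtain ⟨h0, h1⟩ := hx a
  simp only [obsProb, Fintype.sum_bool, if_true, Bool.false_eq_true, if_false]
  rw [← ENNReal.ofReal_add h0 (by linarith)]
  simp

lemma toReal_obsProb_true {x : Params N} (hx : IsUnitParams x) (a : Act N) :
    (obsProb x a true).toReal = successProb x a := by
  simp [obsProb, (hx a).1]

lemma toReal_obsProb_false {x : Params N} (hx : IsUnitParams x) (a : Act N) :
    (obsProb x a false).toReal = 1 - successProb x a := by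
  simp [obsProb, (hx a).2]

lemma sum_stepProb {x : Params N} (hx : IsUnitParams x) (q : PMF (Act N)) :
    ∑ y, stepProb q x y = 1 := by
  simp only [stepProb, Fintype.sum_prod_type]
  simp_rw [← Finset.mul_sum, sum_obsProb hx, mul_one]
  rw [← tsum_fintype (L := .unconditional _)]
  exact q.tsum_coe

lemma sum_toReal_pmf (q : PMF (Act N)) : ∑ a, (q a).toReal = 1 := by
  rw [← ENNReal.toReal_sum fun a _ => q.apply_ne_top a, ← tsum_fintype (L := .unconditional _),
    q.tsum_coe, ENNReal.toReal_one]

lemma meanReward_inl {x : Params N} (hx : IsUnitParams x) (i : Fin N) :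
    meanReward x (Sum.inl i) = x.1 i * x.2 i + (1 - x.1 i) * (1 - x.2 i) := by
  simp only [meanReward, Fintype.sum_bool, toReal_obsProb_true hx, toReal_obsProb_false hx]
  simp [reward, successProb]

lemma meanReward_inr {x : Params N} (hx : IsUnitParams x) (i : Fin N) :
    meanReward x (Sum.inr i) = -1 := by
  simp only [meanReward, Fintype.sum_bool, toReal_obsProb_true hx, toReal_obsProb_false hx, reward]
  ring

lemma meanReward_inl_mem {x : Params N} (hx : IsUnitParams x) (i : Fin N) :
    meanReward x (Sum.inl i) ∈ Set.Icc (0 : ℝ) 1 := by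
  obtain ⟨h1, h2⟩ := hx (Sum.inl i)
  obtain ⟨h3, h4⟩ := hx (Sum.inr i)
  simp only [successProb] at h1 h2 h3 h4
  rw [meanReward_inl hx]
  constructor <;> nlinarith

lemma meanReward_le_optReward (x : Params N) (a : Act N) : meanReward x a ≤ optReward x :=
  le_ciSup (Set.finite_range _).bddAbove a

lemma meanReward_mem {x : Params N} (hx : IsUnitParams x) (a : Act N) :
    meanReward x a ∈ Set.Icc (-1 : ℝ) 1 := by
  cases a with
  | inl i =>
    have := meanReward_inl_mem hx i
    exact ⟨by linarith [this.1], this.2⟩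
  | inr i => rw [meanReward_inr hx]; norm_num

/-- Queries pay `-1` and arms pay at least `0` on average, so only arms compete for the maximum. -/
lemma optReward_eq {x : Params N} (hx : IsUnitParams x) {i : Fin N}
    (hi : ∀ j, meanReward x (Sum.inl j) ≤ meanReward x (Sum.inl i)) :
    optReward x = meanReward x (Sum.inl i) := by
  refine le_antisymm ?_ (meanReward_le_optReward x _)
  have : Nonempty (Act N) := ⟨Sum.inl i⟩
  refine ciSup_le fun a => ?_
  cases a with
  | inl j => exact hi j
  | inr j => rw [meanReward_inr hx]; linarith [(meanReward_inl_mem hx i).1]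

lemma optReward_mem (hN : 1 ≤ N) {x : Params N} (hx : IsUnitParams x) :
    optReward x ∈ Set.Icc (0 : ℝ) 1 := by
  have : Nonempty (Fin N) := ⟨⟨0, hN⟩⟩
  obtain ⟨i, hi⟩ := Finite.exists_max fun i => meanReward x (Sum.inl i)
  rw [optReward_eq hx hi]
  exact meanReward_inl_mem hx i

/-! ### Measurable maximizers and second-moment inequalities. -/

/-- A finite family of measurable real functions has a measurable pointwise maximizer. -/
lemma exists_measurable_argmax {Ω ι : Type*} [MeasurableSpace Ω] [Fintype ι] [Nonempty ι]
    [LinearOrder ι] [MeasurableSpace ι] [MeasurableSingletonClass ι] {f : ι → Ω → ℝ}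
    (hf : ∀ i, Measurable (f i)) :
    ∃ A : Ω → ι, Measurable A ∧ ∀ x j, f j x ≤ f (A x) x := by
  classical
  have hne : ∀ x, (Finset.univ.filter fun i => ∀ j, f j x ≤ f i x).Nonempty := fun x => by
    obtain ⟨i, hi⟩ := Finite.exists_max fun i => f i x
    exact ⟨i, by simpa using hi⟩
  -- Ties go to the least index, so each fibre is a finite Boolean combination of comparison sets.
  refine ⟨fun x => (Finset.univ.filter fun i => ∀ j, f j x ≤ f i x).min' (hne x), ?_, ?_⟩
  · refine measurable_to_countable' fun i => ?_
    have hE : ∀ k, MeasurableSet {x | ∀ j, f j x ≤ f k x} := fun k => by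
      simp only [Set.ofPred_forall]
      exact MeasurableSet.iInter fun j => measurableSet_le (hf j) (hf k)
    have : (fun x => (Finset.univ.filter fun i => ∀ j, f j x ≤ f i x).min' (hne x)) ⁻¹' {i} =
        {x | ∀ j, f j x ≤ f i x} ∩ ⋂ k : {k // k < i}, {x | ∀ j, f j x ≤ f k x}ᶜ := by
      ext x
      simp only [Set.mem_preimage, Set.mem_singleton_iff, Finset.min'_eq_iff, Finset.mem_filter,
        Finset.mem_univ, true_and, Set.mem_inter_iff, Set.mem_ofPred_eq, Set.mem_iInter,
        Set.mem_compl_iff, Subtype.forall]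
      refine and_congr_right fun _ => forall_congr' fun k => ?_
      rw [← not_lt]
      tauto
    rw [this]
    exact (hE i).inter (MeasurableSet.iInter fun k => (hE k).compl)
  · intro x j
    exact (Finset.mem_filter.1 (Finset.min'_mem _ (hne x))).2 j

/-- A measurable function that is almost everywhere bounded is integrable. -/
lemma integrable_of_abs_le {Ω : Type*} [MeasurableSpace Ω] {μ : Measure Ω} [IsFiniteMeasure μ]
    {f : Ω → ℝ} (hf : Measurable f) {C : ℝ} (h : ∀ᵐ x ∂μ, |f x| ≤ C) : Integrable f μ :=
  Integrable.of_bound hf.aestronglyMeasurable C h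

lemma integral_mul_sub_sq {Ω : Type*} [MeasurableSpace Ω] {μ : Measure Ω} [IsFiniteMeasure μ]
    {f : Ω → ℝ} (hf : Integrable f μ) (hf2 : Integrable (fun x => f x ^ 2) μ) (a c : ℝ) :
    ∫ x, (a * f x - c) ^ 2 ∂μ =
      a ^ 2 * ∫ x, f x ^ 2 ∂μ - 2 * a * c * ∫ x, f x ∂μ + c ^ 2 * μ.real Set.univ := by
  have h : ∀ x, (a * f x - c) ^ 2 = a ^ 2 * f x ^ 2 - 2 * a * c * f x + c ^ 2 := fun x => by ring
  have h1 : Integrable (fun x => a ^ 2 * f x ^ 2 - 2 * a * c * f x) μ :=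
    (hf2.const_mul _).sub (hf.const_mul _)
  simp_rw [h]
  rw [integral_add h1 (integrable_const _), integral_sub (hf2.const_mul _) (hf.const_mul _),
    integral_const_mul, integral_const_mul, integral_const, smul_eq_mul]
  ring

/-- Cauchy-Schwarz against the constant 1, for measures of any finite mass: it is applied to
restrictions to the event that a given arm is optimal. -/
lemma sq_integral_le {Ω : Type*} [MeasurableSpace Ω] {μ : Measure Ω} [IsFiniteMeasure μ]
    {f : Ω → ℝ} (hf : Integrable f μ) (hf2 : Integrable (fun x => f x ^ 2) μ) :
    (∫ x, f x ∂μ) ^ 2 ≤ μ.real Set.univ * ∫ x, f x ^ 2 ∂μ := by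
  have hP0 : 0 ≤ μ.real Set.univ := measureReal_nonneg
  rcases hP0.eq_or_lt with h0 | h0
  · have : μ = 0 := by
      rw [← Measure.measure_univ_eq_zero, ← measureReal_eq_zero_iff]; exact h0.symm
    simp [this]
  · have h1 : 0 ≤ ∫ x, (μ.real Set.univ * f x - ∫ y, f y ∂μ) ^ 2 ∂μ :=
      integral_nonneg fun x => sq_nonneg _
    rw [integral_mul_sub_sq hf hf2] at h1
    have h2 : 0 ≤ μ.real Set.univ *
        (μ.real Set.univ * ∫ x, f x ^ 2 ∂μ - (∫ x, f x ∂μ) ^ 2) := by linarith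
    have := nonneg_of_mul_nonneg_right h2 h0
    linarith

lemma integral_sub_integral_sq_le {Ω : Type*} [MeasurableSpace Ω] {μ : Measure Ω}
    [IsProbabilityMeasure μ] {f : Ω → ℝ} (hf : Integrable f μ)
    (hf2 : Integrable (fun x => f x ^ 2) μ) (c : ℝ) :
    ∫ x, (f x - ∫ y, f y ∂μ) ^ 2 ∂μ ≤ ∫ x, (f x - c) ^ 2 ∂μ := by
  have key := integral_mul_sub_sq hf hf2 1
  simp only [one_mul, probReal_univ] at key
  rw [key, key]
  nlinarith [sq_nonneg (c - ∫ x, f x ∂μ)]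

/-! ### Information gain, variance and regret of single actions. -/

/-- The information gained about the parameters of law `μ` by observing the outcome of `a`. -/
def gain (μ : Measure (Params N)) (a : Act N) : ℝ≥0∞ :=
  ∑ o, ∫⁻ x, (∫⁻ x', obsProb x' a o ∂μ) *
    ENNReal.ofReal (klFun (obsProb x a o / ∫⁻ x', obsProb x' a o ∂μ).toReal) ∂μ

/-- The mean of the success probability of `a` under `μ`. -/
def obsMean (μ : Measure (Params N)) (a : Act N) : ℝ := ∫ x, successProb x a ∂μ

/-- The variance of the success probability of `a` under `μ`. -/
def obsVar (μ : Measure (Params N)) (a : Act N) : ℝ :=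
  ∫ x, (successProb x a - obsMean μ a) ^ 2 ∂μ

/-- The expected regret of `a` when the parameters have law `μ`. -/
def expRegret (μ : Measure (Params N)) (a : Act N) : ℝ := ∫ x, (optReward x - meanReward x a) ∂μ

/-- The action is drawn independently of the parameters, so `q a` cancels in the density ratio and
survives only as a weight. Thus information, like regret, is affine in `q`. -/
lemma mutualInfo_stepLaw {μ : Measure (Params N)} [IsProbabilityMeasure μ]
    (hμ : ∀ᵐ x ∂μ, IsUnitParams x) (q : PMF (Act N)) :
    mutualInfo (stepLaw μ q) = ∑ a, q a * gain μ a := by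
  unfold stepLaw
  rw [mutualInfo_withDensity_prod_count μ (measurable_stepProb q)
    (hμ.mono fun x hx => sum_stepProb hx q), Fintype.sum_prod_type]
  refine Finset.sum_congr rfl fun a _ => ?_
  rw [gain, Finset.mul_sum]
  refine Finset.sum_congr rfl fun o _ => ?_
  simp only [stepProb]
  have hkl := measurable_klFun
  have hm : Measurable fun x => (∫⁻ x', obsProb x' a o ∂μ) *
      ENNReal.ofReal (klFun (obsProb x a o / ∫⁻ x', obsProb x' a o ∂μ).toReal) := by fun_prop
  have e : ∫⁻ x, q a * obsProb x a o ∂μ = q a * ∫⁻ x, obsProb x a o ∂μ :=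
    lintegral_const_mul _ (by fun_prop)
  rw [e, ← lintegral_const_mul _ hm]
  refine lintegral_congr fun x => ?_
  by_cases h : q a = 0
  · simp [h]
  · rw [ENNReal.mul_div_mul_left _ _ h (q.apply_ne_top a), mul_assoc]

lemma integrable_successProb {μ : Measure (Params N)} [IsFiniteMeasure μ]
    (hμ : ∀ᵐ x ∂μ, IsUnitParams x) (a : Act N) : Integrable (fun x => successProb x a) μ :=
  integrable_of_abs_le (C := 1) (by fun_prop) <| hμ.mono fun x hx => by
    rw [abs_le]; constructor <;> linarith [(hx a).1, (hx a).2]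

lemma obsMean_mem {μ : Measure (Params N)} [IsProbabilityMeasure μ]
    (hμ : ∀ᵐ x ∂μ, IsUnitParams x) (a : Act N) : obsMean μ a ∈ Set.Icc (0 : ℝ) 1 := by
  refine ⟨integral_nonneg_of_ae (hμ.mono fun x hx => (hx a).1), ?_⟩
  have := integral_mono_ae (integrable_successProb hμ a) (integrable_const (1 : ℝ))
    (hμ.mono fun x hx => (hx a).2)
  rw [integral_const, probReal_univ, one_smul] at this
  exact this

lemma integrable_sq_sub {μ : Measure (Params N)} [IsProbabilityMeasure μ]
    (hμ : ∀ᵐ x ∂μ, IsUnitParams x) (a : Act N) :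
    Integrable (fun x => (successProb x a - obsMean μ a) ^ 2) μ :=
  integrable_of_abs_le (C := 1) (by fun_prop) <| hμ.mono fun x hx => by
    have h1 := hx a
    have h2 := obsMean_mem hμ a
    rw [abs_of_nonneg (sq_nonneg _), sq_le_one_iff_abs_le_one, abs_le]
    constructor <;> linarith [h1.1, h1.2, h2.1, h2.2]

lemma lintegral_obsProb_true {μ : Measure (Params N)} [IsFiniteMeasure μ]
    (hμ : ∀ᵐ x ∂μ, IsUnitParams x) (a : Act N) :
    ∫⁻ x, obsProb x a true ∂μ = ENNReal.ofReal (obsMean μ a) := by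
  rw [obsMean, ofReal_integral_eq_lintegral_ofReal (integrable_successProb hμ a)
    (hμ.mono fun x hx => (hx a).1)]
  simp [obsProb]

lemma lintegral_obsProb_false {μ : Measure (Params N)} [IsProbabilityMeasure μ]
    (hμ : ∀ᵐ x ∂μ, IsUnitParams x) (a : Act N) :
    ∫⁻ x, obsProb x a false ∂μ = ENNReal.ofReal (1 - obsMean μ a) := by
  have : 1 - obsMean μ a = ∫ x, (1 - successProb x a) ∂μ := by
    rw [integral_sub (integrable_const _) (integrable_successProb hμ a), obsMean]
    simp
  have hi : Integrable (fun x => 1 - successProb x a) μ :=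
    (integrable_const _).sub (integrable_successProb hμ a)
  rw [this, ofReal_integral_eq_lintegral_ofReal hi
    (hμ.mono fun x hx => sub_nonneg.2 (hx a).2)]
  simp [obsProb]

lemma gain_eq {μ : Measure (Params N)} [IsProbabilityMeasure μ]
    (hμ : ∀ᵐ x ∂μ, IsUnitParams x) {a : Act N} (hm : obsMean μ a ∈ Set.Ioo (0 : ℝ) 1) :
    gain μ a = ∫⁻ x, ENNReal.ofReal (obsMean μ a * klFun (successProb x a / obsMean μ a) +
      (1 - obsMean μ a) * klFun ((1 - successProb x a) / (1 - obsMean μ a))) ∂μ := by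
  have hkl := measurable_klFun
  have h1 : 0 < 1 - obsMean μ a := sub_pos.2 hm.2
  rw [gain, Fintype.sum_bool, lintegral_obsProb_true hμ, lintegral_obsProb_false hμ,
    ← lintegral_add_left (by fun_prop)]
  refine lintegral_congr_ae (hμ.mono fun x hx => ?_)
  simp only [ENNReal.toReal_div, ENNReal.toReal_ofReal hm.1.le, ENNReal.toReal_ofReal h1.le,
    toReal_obsProb_true hx, toReal_obsProb_false hx]
  have h3 : 0 ≤ 1 - successProb x a := sub_nonneg.2 (hx a).2
  rw [ENNReal.ofReal_add (mul_nonneg hm.1.le (klFun_nonneg (div_nonneg (hx a).1 hm.1.le)))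
    (mul_nonneg h1.le (klFun_nonneg (div_nonneg h3 h1.le))), ENNReal.ofReal_mul hm.1.le,
    ENNReal.ofReal_mul h1.le]

/-- The chi-square bounds for the two outcomes add up through `1 / m + 1 / (1 - m) = 1 / (m (1 -
m))`. -/
lemma gain_le {μ : Measure (Params N)} [IsProbabilityMeasure μ]
    (hμ : ∀ᵐ x ∂μ, IsUnitParams x) {a : Act N} (hm : obsMean μ a ∈ Set.Ioo (0 : ℝ) 1) :
    gain μ a ≤ ENNReal.ofReal (obsVar μ a / (obsMean μ a * (1 - obsMean μ a))) := by
  have h1 : 0 < 1 - obsMean μ a := sub_pos.2 hm.2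
  have h0 := hm.1
  rw [gain_eq hμ hm, obsVar, ← integral_div, ofReal_integral_eq_lintegral_ofReal
    ((integrable_sq_sub hμ a).div_const _)
    (ae_of_all _ fun x => div_nonneg (sq_nonneg _) (mul_pos h0 h1).le)]
  refine lintegral_mono_ae (hμ.mono fun x hx => ENNReal.ofReal_le_ofReal ?_)
  have h3 := mul_klFun_div_le (hx a).1 hm.1
  have h4 := mul_klFun_div_le (sub_nonneg.2 (hx a).2) h1
  refine (add_le_add h3 h4).trans_eq ?_
  field_simp
  ring

/-- Each of the two outcomes contributes a quarter of the variance by the Hellinger bound. -/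
lemma le_gain {μ : Measure (Params N)} [IsProbabilityMeasure μ]
    (hμ : ∀ᵐ x ∂μ, IsUnitParams x) {a : Act N} (hm : obsMean μ a ∈ Set.Ioo (0 : ℝ) 1) :
    ENNReal.ofReal (obsVar μ a / 2) ≤ gain μ a := by
  have h1 : 0 < 1 - obsMean μ a := sub_pos.2 hm.2
  rw [gain_eq hμ hm, obsVar, ← integral_div, ofReal_integral_eq_lintegral_ofReal
    ((integrable_sq_sub hμ a).div_const _) (ae_of_all _ fun x => by positivity)]
  refine lintegral_mono_ae (hμ.mono fun x hx => ENNReal.ofReal_le_ofReal ?_)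
  have h3 := le_mul_klFun_div (hx a).1 (hx a).2 hm.1 hm.2.le
  have h4 := le_mul_klFun_div (sub_nonneg.2 (hx a).2) (by linarith [(hx a).1]) h1
    (by linarith [hm.1])
  refine le_trans (le_of_eq ?_) (add_le_add h3 h4)
  ring

lemma toReal_obsProb_mem {x : Params N} (hx : IsUnitParams x) (a : Act N) (o : Bool) :
    (obsProb x a o).toReal ∈ Set.Icc (0 : ℝ) 1 := by
  cases o
  · rw [toReal_obsProb_false hx]; exact ⟨sub_nonneg.2 (hx a).2, by linarith [(hx a).1]⟩
  · rw [toReal_obsProb_true hx]; exact hx a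

lemma abs_optReward_sub_reward_le (hN : 1 ≤ N) {x : Params N} (hx : IsUnitParams x) (a : Act N)
    (o : Bool) : |optReward x - reward a o x.2| ≤ 2 := by
  have h2 := optReward_mem hN hx
  have h3 : reward a o x.2 ∈ Set.Icc (-1 : ℝ) 1 := by
    rcases a with i | i
    · have := hx (Sum.inr i)
      simp only [successProb] at this
      cases o <;> simp only [reward] <;> simp <;> constructor <;> linarith [this.1, this.2]
    · simp [reward]
  rw [abs_le]
  constructor <;> linarith [h2.1, h2.2, h3.1, h3.2]

@[fun_prop]
lemma measurable_reward_snd (a : Act N) (o : Bool) :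
    Measurable fun x : Params N => reward a o x.2 :=
  measurable_reward.comp (measurable_id.prodMk (measurable_const (a := (a, o))))

lemma integrable_obsProb_mul (hN : 1 ≤ N) {μ : Measure (Params N)} [IsFiniteMeasure μ]
    (hμ : ∀ᵐ x ∂μ, IsUnitParams x) (a : Act N) (o : Bool) :
    Integrable (fun x => (obsProb x a o).toReal * (optReward x - reward a o x.2)) μ := by
  refine integrable_of_abs_le (C := 2) (by fun_prop) (hμ.mono fun x hx => ?_)
  have h1 := toReal_obsProb_mem hx a o
  have h4 := abs_optReward_sub_reward_le hN hx a o
  rw [abs_mul, abs_of_nonneg h1.1]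
  nlinarith [h1.1, h1.2, abs_nonneg (optReward x - reward a o x.2)]

lemma sum_integral_stepProb_mul (hN : 1 ≤ N) {μ : Measure (Params N)} [IsFiniteMeasure μ]
    (hμ : ∀ᵐ x ∂μ, IsUnitParams x) (q : PMF (Act N)) :
    ∑ y : Act N × Bool, ∫ x, (stepProb q x y).toReal * (optReward x - reward y.1 y.2 x.2) ∂μ =
      ∑ a, (q a).toReal * expRegret μ a := by
  rw [Fintype.sum_prod_type]
  refine Finset.sum_congr rfl fun a _ => ?_
  simp only [stepProb, ENNReal.toReal_mul, mul_assoc, integral_const_mul]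
  rw [← Finset.mul_sum, expRegret,
    ← integral_finsetSum _ fun o _ => integrable_obsProb_mul hN hμ a o]
  congr 1
  refine integral_congr_ae (hμ.mono fun x hx => ?_)
  have h := congrArg ENNReal.toReal (sum_obsProb hx a)
  rw [ENNReal.toReal_sum fun o _ => obsProb_ne_top x a o, ENNReal.toReal_one] at h
  simp only [mul_sub, Finset.sum_sub_distrib, ← Finset.sum_mul, h, one_mul, meanReward]

lemma integral_stepLaw (hN : 1 ≤ N) {μ : Measure (Params N)} [IsProbabilityMeasure μ]
    (hμ : ∀ᵐ x ∂μ, IsUnitParams x) (q : PMF (Act N)) :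
    ∫ z, (optReward z.1 - reward z.2.1 z.2.2 z.1.2) ∂(stepLaw μ q) =
      ∑ a, (q a).toReal * expRegret μ a := by
  rw [← sum_integral_stepProb_mul hN hμ]
  refine integral_withDensity_prod_count μ (measurable_stepProb q)
    (fun z => stepProb_ne_top q z.1 z.2) ?_
    ((measurable_optReward.comp measurable_fst).sub measurable_reward)
  rintro ⟨a, o⟩
  simp only [stepProb, ENNReal.toReal_mul, mul_assoc]
  exact (integrable_obsProb_mul hN hμ a o).const_mul _

lemma integrable_optReward (hN : 1 ≤ N) {μ : Measure (Params N)} [IsFiniteMeasure μ]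
    (hμ : ∀ᵐ x ∂μ, IsUnitParams x) : Integrable (fun x => optReward x) μ :=
  integrable_of_abs_le (C := 1) (by fun_prop) <| hμ.mono fun x hx => by
    have := optReward_mem hN hx
    rw [abs_le]; constructor <;> linarith [this.1, this.2]

lemma integrable_meanReward {μ : Measure (Params N)} [IsFiniteMeasure μ]
    (hμ : ∀ᵐ x ∂μ, IsUnitParams x) (a : Act N) : Integrable (fun x => meanReward x a) μ :=
  integrable_of_abs_le (C := 1) (by fun_prop) <| hμ.mono fun x hx =>
    abs_le.2 (meanReward_mem hx a)

lemma expRegret_nonneg (μ : Measure (Params N)) (a : Act N) : 0 ≤ expRegret μ a :=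
  integral_nonneg fun x => sub_nonneg.2 (meanReward_le_optReward x a)

lemma expRegret_le {μ : Measure (Params N)} [IsProbabilityMeasure μ] (hN : 1 ≤ N)
    (hμ : ∀ᵐ x ∂μ, IsUnitParams x) {a : Act N} {C : ℝ}
    (h : ∀ x, IsUnitParams x → 1 - C ≤ meanReward x a) : expRegret μ a ≤ C := by
  have h1 : Integrable (fun x => optReward x - meanReward x a) μ :=
    (integrable_optReward hN hμ).sub (integrable_meanReward hμ a)
  have := integral_mono_ae h1 (integrable_const C) (hμ.mono fun x hx => by
    linarith [h x hx, (optReward_mem hN hx).2])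
  rwa [integral_const, probReal_univ, one_smul] at this

/-! ### Regret of probability matching in terms of parameter variances. -/

/-- The mean reward of an arm varies at most as much as the two parameters of the arm. -/
lemma integral_meanReward_sub_sq_le {μ : Measure (Params N)} [IsProbabilityMeasure μ]
    (hμ : ∀ᵐ x ∂μ, IsUnitParams x) (i : Fin N) :
    ∫ x, (meanReward x (Sum.inl i) - ∫ y, meanReward y (Sum.inl i) ∂μ) ^ 2 ∂μ ≤
      2 * (obsVar μ (Sum.inl i) + obsVar μ (Sum.inr i)) := by
  set m := obsMean μ (Sum.inl i) with hm
  set n := obsMean μ (Sum.inr i) with hn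
  have hm1 := obsMean_mem hμ (Sum.inl i)
  have hn1 := obsMean_mem hμ (Sum.inr i)
  rw [← hm] at hm1
  rw [← hn] at hn1
  have hi2 : Integrable (fun x => meanReward x (Sum.inl i) ^ 2) μ :=
    integrable_of_abs_le (C := 1) (by fun_prop) <| hμ.mono fun x hx => by
      have := meanReward_mem hx (Sum.inl i)
      rw [abs_of_nonneg (sq_nonneg _), sq_le_one_iff_abs_le_one]
      exact abs_le.2 this
  -- The mean minimizes the squared deviation, so it may be replaced by the reward at the mean
  -- parameters. No independence of `φ i` and `θ i` under `μ` is needed for this.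
  refine (integral_sub_integral_sq_le (integrable_meanReward hμ _) hi2
    (m * n + (1 - m) * (1 - n))).trans ?_
  rw [obsVar, obsVar, ← integral_add (integrable_sq_sub hμ _) (integrable_sq_sub hμ _),
    ← integral_const_mul]
  refine integral_mono_of_nonneg (ae_of_all _ fun x => sq_nonneg _)
    (((integrable_sq_sub hμ _).add (integrable_sq_sub hμ _)).const_mul _) (hμ.mono fun x hx => ?_)
  have h1 := hx (Sum.inl i)
  have h2 := hx (Sum.inr i)
  simp only [meanReward_inl hx, successProb, ← hm, ← hn] at h1 h2 ⊢
  have e : x.1 i * x.2 i + (1 - x.1 i) * (1 - x.2 i) - (m * n + (1 - m) * (1 - n)) =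
      (2 * x.2 i - 1) * (x.1 i - m) + (2 * m - 1) * (x.2 i - n) := by ring
  rw [e]
  have h3 : (2 * x.2 i - 1) ^ 2 ≤ 1 := by nlinarith [h2.1, h2.2]
  have h4 : (2 * m - 1) ^ 2 ≤ 1 := by nlinarith [hm1.1, hm1.2]
  have h5 := mul_le_mul_of_nonneg_right h3 (sq_nonneg (x.1 i - m))
  have h6 := mul_le_mul_of_nonneg_right h4 (sq_nonneg (x.2 i - n))
  nlinarith [sq_nonneg ((2 * x.2 i - 1) * (x.1 i - m) - (2 * m - 1) * (x.2 i - n))]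

/-- The regret of sampling an arm with its probability of being optimal is controlled by the
variances of the parameters of the sampled arm. -/
theorem exists_thompson_weights (hN : 1 ≤ N) {μ : Measure (Params N)} [IsProbabilityMeasure μ]
    (hμ : ∀ᵐ x ∂μ, IsUnitParams x) :
    ∃ p : Fin N → ℝ, (∀ i, 0 ≤ p i) ∧ ∑ i, p i = 1 ∧
      (∑ i, p i * expRegret μ (Sum.inl i)) ^ 2 ≤
        2 * N * ∑ i, p i * (obsVar μ (Sum.inl i) + obsVar μ (Sum.inr i)) := by
  have : Nonempty (Fin N) := ⟨⟨0, hN⟩⟩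
  obtain ⟨A, hA, hAmax⟩ := exists_measurable_argmax
    fun i : Fin N => measurable_meanReward (Sum.inl i)
  have hS : ∀ i, MeasurableSet (A ⁻¹' {i}) := fun i => hA (measurableSet_singleton i)
  have hsum : ∑ i, μ.real (A ⁻¹' {i}) = 1 := by
    rw [sum_measureReal_preimage_singleton _ fun i _ => hS i]
    simp
  refine ⟨fun i => μ.real (A ⁻¹' {i}), fun i => measureReal_nonneg, hsum, ?_⟩
  have hR := fun i : Fin N => integrable_meanReward hμ (Sum.inl i)
  set r : Fin N → ℝ := fun i => ∫ y, meanReward y (Sum.inl i) ∂μ with hr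
  have hopt : ∫ x, optReward x ∂μ = ∑ i, ∫ x in A ⁻¹' {i}, meanReward x (Sum.inl i) ∂μ := by
    simp_rw [← integral_indicator (hS _)]
    rw [← integral_finsetSum _ fun i _ => (hR i).indicator (hS i)]
    refine integral_congr_ae (hμ.mono fun x hx => ?_)
    simp only [Set.indicator, Set.mem_preimage, Set.mem_singleton_iff]
    rw [Finset.sum_ite_eq, if_pos (Finset.mem_univ _)]
    exact optReward_eq hx (hAmax x)
  -- Choosing arm `i` with the probability that it is optimal leaves as regret the excess of its
  -- reward over its mean, on the event that it is optimal. Cauchy-Schwarz over the arms costs the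
  -- factor `N`; on each event it produces the probability times a variance.
  have hD : ∑ i, μ.real (A ⁻¹' {i}) * expRegret μ (Sum.inl i) =
      ∑ i, ∫ x in A ⁻¹' {i}, (meanReward x (Sum.inl i) - r i) ∂μ := by
    have h1 : ∀ i, expRegret μ (Sum.inl i) = ∫ x, optReward x ∂μ - r i := fun i =>
      integral_sub (integrable_optReward hN hμ) (hR i)
    have h2 : ∀ i, ∫ x in A ⁻¹' {i}, (meanReward x (Sum.inl i) - r i) ∂μ =
        ∫ x in A ⁻¹' {i}, meanReward x (Sum.inl i) ∂μ - μ.real (A ⁻¹' {i}) * r i := fun i => by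
      rw [integral_sub (hR i).integrableOn (integrable_const _)]
      simp
    simp_rw [h1, h2, mul_sub, Finset.sum_sub_distrib, ← Finset.sum_mul, hsum, hopt, one_mul]
  rw [hD]
  refine sq_sum_le_card_mul_sum_sq.trans ?_
  rw [Finset.card_univ, Fintype.card_fin, mul_comm (2 : ℝ), mul_assoc, Finset.mul_sum _ _ (2 : ℝ)]
  refine mul_le_mul_of_nonneg_left (Finset.sum_le_sum fun i _ => ?_) (Nat.cast_nonneg N)
  have hZ : Integrable (fun x => meanReward x (Sum.inl i) - r i) μ :=
    (hR i).sub (integrable_const _)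
  have hri : |r i| ≤ 1 := by
    have := norm_integral_le_of_norm_le_const (μ := μ) (C := 1)
      (f := fun x => meanReward x (Sum.inl i))
      (hμ.mono fun x hx => abs_le.2 (meanReward_mem hx (Sum.inl i)))
    simpa using this
  have hZ2 : Integrable (fun x => (meanReward x (Sum.inl i) - r i) ^ 2) μ :=
    integrable_of_abs_le (C := 4) (by fun_prop) <| hμ.mono fun x hx => by
      have h1 := meanReward_mem hx (Sum.inl i)
      rw [abs_le] at hri
      rw [abs_of_nonneg (sq_nonneg _)]
      nlinarith [h1.1, h1.2, hri.1, hri.2]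
  refine (sq_integral_le hZ.integrableOn hZ2.integrableOn).trans ?_
  rw [measureReal_restrict_apply_univ]
  calc _ ≤ μ.real (A ⁻¹' {i}) * ∫ x, (meanReward x (Sum.inl i) - r i) ^ 2 ∂μ :=
        mul_le_mul_of_nonneg_left
          (setIntegral_le_integral hZ2 (ae_of_all _ fun x => sq_nonneg _)) measureReal_nonneg
    _ ≤ μ.real (A ⁻¹' {i}) * (2 * (obsVar μ (Sum.inl i) + obsVar μ (Sum.inr i))) :=
        mul_le_mul_of_nonneg_left (integral_meanReward_sub_sq_le hμ i) measureReal_nonneg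
    _ = _ := by ring

/-! ### From a minimal information ratio to the cubic one-step bound. -/

/-- If the squared regret per information is minimal at `(d, i)` along the segment to `(d', i')`,
then the cubed regret per information at `(d, i)` is at most four times the value obtained from
the regret and the squared regret per information at `(d', i')`. -/
lemma cube_le_of_ratio_minimal {d i d' i' D C : ℝ} (hd : 0 ≤ d) (hi : 0 ≤ i) (hd' : 0 ≤ d')
    (hi' : 0 ≤ i') (hD : 0 ≤ D) (hC : 0 ≤ C) (hdD : d' ≤ 2 * D) (hDi : D ^ 3 ≤ C * i')
    (h0 : i = 0 → d = 0)
    (h : ∀ s ∈ Set.Icc (0 : ℝ) 1,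
      d ^ 2 * (i + s * (i' - i)) ≤ (d + s * (d' - d)) ^ 2 * i) :
    d ^ 3 ≤ 16 * C * i := by
  rcases hd.eq_or_lt with rfl | hd
  · have := mul_nonneg hC hi
    nlinarith
  have hi : 0 < i := lt_of_le_of_ne hi fun h => hd.ne' (h0 h.symm)
  have h1 := h 1 (by norm_num)
  -- The first-order condition at `s = 0`. If it failed by `e > 0`, the hypothesis would give `d * e
  -- ≤ s * (d' - d) ^ 2 * i` for every `s` in `(0, 1]`. The choice `s = e * d / (2 * K)` lies there
  -- and makes the right side at most `e * d / 2`.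
  have key : d * (i' - i) ≤ 2 * (d' - d) * i := by
    by_contra hcon
    push Not at hcon
    set e := d * (i' - i) - 2 * (d' - d) * i with he
    have he0 : 0 < e := by linarith
    set K := (d' - d) ^ 2 * i + e * d with hK
    have hK0 : 0 < K := by positivity
    have hKe : e * d ≤ K := by
      have : 0 ≤ (d' - d) ^ 2 * i := by positivity
      linarith
    have hs0 : 0 < e * d / (2 * K) := by positivity
    have hs1 : e * d / (2 * K) ≤ 1 := by
      rw [div_le_one (by positivity)]; linarith
    have h2 := h _ ⟨hs0.le, hs1⟩
    set s := e * d / (2 * K) with hs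
    have hsK : s * (2 * K) = e * d := by rw [hs]; field_simp
    have h3 : s * (d * e) ≤ s * (s * ((d' - d) ^ 2 * i)) := by rw [he]; nlinarith
    have h4 := le_of_mul_le_mul_left h3 hs0
    have h5 : s * ((d' - d) ^ 2 * i) ≤ s * K :=
      mul_le_mul_of_nonneg_left (by rw [hK]; have := mul_pos he0 hd; linarith) hs0.le
    have := mul_pos he0 hd
    nlinarith
  have hdd : d ≤ 2 * d' := by
    have h3 : d * i ≤ 2 * d' * i := by
      have := mul_nonneg hd.le hi'
      nlinarith
    exact le_of_mul_le_mul_right h3 hi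
  have hD0 : 0 < D := by linarith
  -- The other use of minimality: the comparison with the far endpoint `s = 1`.
  have h5 : d ^ 2 * i' ≤ 4 * D ^ 2 * i := by
    have h6 : d' ^ 2 ≤ 4 * D ^ 2 := by nlinarith
    have h7 := mul_le_mul_of_nonneg_right h6 hi.le
    have h8 : d ^ 2 * i' ≤ d' ^ 2 * i := by
      have e1 : i + 1 * (i' - i) = i' := by ring
      have e2 : d + 1 * (d' - d) = d' := by ring
      rwa [e1, e2] at h1
    linarith
  have h9 : d ^ 2 * D ≤ 4 * C * i := by
    have h10 : D ^ 2 * (d ^ 2 * D) ≤ D ^ 2 * (4 * C * i) := by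
      have h11 := mul_le_mul_of_nonneg_left hDi (sq_nonneg d)
      have h12 := mul_le_mul_of_nonneg_left h5 hC
      nlinarith
    exact le_of_mul_le_mul_left h10 (by positivity)
  have h13 : d ≤ 4 * D := by linarith
  have h14 := mul_le_mul_of_nonneg_left h13 (sq_nonneg d)
  nlinarith

/-- The probability mass function with given real weights. -/
def pmfOfWeights (w : Act N → ℝ) (h0 : ∀ a, 0 ≤ w a) (h1 : ∑ a, w a = 1) : PMF (Act N) :=
  PMF.ofFintype (fun a => ENNReal.ofReal (w a)) (by
    rw [← ENNReal.ofReal_sum_of_nonneg fun a _ => h0 a, h1, ENNReal.ofReal_one])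

lemma toReal_pmfOfWeights (w : Act N → ℝ) (h0 : ∀ a, 0 ≤ w a) (h1 : ∑ a, w a = 1) (a : Act N) :
    (pmfOfWeights w h0 h1 a).toReal = w a := by
  simp [pmfOfWeights, h0 a]

/-- A distribution over actions whose regret is at most twice `D` and whose information is at
least `D ^ 3 / (8 N)`. -/
lemma exists_informative_weights (hN : 1 ≤ N) {μ : Measure (Params N)} [IsProbabilityMeasure μ]
    (hμ : ∀ᵐ x ∂μ, IsUnitParams x) {g : Act N → ℝ} (hg : ∀ a, obsVar μ a / 2 ≤ g a) :
    ∃ (w : Act N → ℝ) (D : ℝ), (∀ a, 0 ≤ w a) ∧ ∑ a, w a = 1 ∧ 0 ≤ D ∧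
      ∑ a, w a * expRegret μ a ≤ 2 * D ∧ D ^ 3 ≤ 8 * N * ∑ a, w a * g a := by
  obtain ⟨p, hp0, hp1, hp⟩ := exists_thompson_weights hN hμ
  set D := ∑ i, p i * expRegret μ (Sum.inl i) with hD
  have hD0 : 0 ≤ D := Finset.sum_nonneg fun i _ => mul_nonneg (hp0 i) (expRegret_nonneg μ _)
  have hD1 : D ≤ 1 := by
    rw [← hp1]
    refine Finset.sum_le_sum fun i _ => mul_le_of_le_one_right (hp0 i) (expRegret_le hN hμ ?_)
    intro x hx
    linarith [(meanReward_inl_mem hx i).1]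
  -- Queries have regret at most 2, so querying with probability `D / 2` adds at most `D` to the
  -- regret.
  refine ⟨Sum.elim (fun i => (1 - D / 2) * p i) (fun i => D / 2 * p i), D, ?_, ?_, hD0, ?_, ?_⟩
  · rintro (i | i)
    · exact mul_nonneg (by linarith) (hp0 i)
    · exact mul_nonneg (by linarith) (hp0 i)
  · simp only [Fintype.sum_sum_type, Sum.elim_inl, Sum.elim_inr, ← Finset.mul_sum, hp1]
    ring
  · simp only [Fintype.sum_sum_type, Sum.elim_inl, Sum.elim_inr, mul_assoc, ← Finset.mul_sum, ← hD]
    have h1 : ∑ i, p i * expRegret μ (Sum.inr i) ≤ 2 := by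
      calc _ ≤ ∑ i, p i * 2 := Finset.sum_le_sum fun i _ => mul_le_mul_of_nonneg_left
            (expRegret_le hN hμ fun x hx => by rw [meanReward_inr hx]; norm_num) (hp0 i)
        _ = 2 := by rw [← Finset.sum_mul, hp1, one_mul]
    nlinarith
  · simp only [Fintype.sum_sum_type, Sum.elim_inl, Sum.elim_inr, mul_assoc, ← Finset.mul_sum]
    set V := ∑ i, p i * (obsVar μ (Sum.inl i) + obsVar μ (Sum.inr i)) with hV
    have hv : ∀ a, 0 ≤ obsVar μ a := fun a => integral_nonneg fun x => sq_nonneg _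
    have hl : 0 ≤ ∑ i, p i * g (Sum.inl i) :=
      Finset.sum_nonneg fun i _ => mul_nonneg (hp0 i) (by linarith [hg (Sum.inl i), hv (Sum.inl i)])
    have h2 : V / 2 ≤ ∑ i, p i * g (Sum.inl i) + ∑ i, p i * g (Sum.inr i) := by
      rw [hV, Finset.sum_div, ← Finset.sum_add_distrib]
      refine Finset.sum_le_sum fun i _ => ?_
      have := mul_le_mul_of_nonneg_left (add_le_add (hg (Sum.inl i)) (hg (Sum.inr i))) (hp0 i)
      linarith
    set a := ∑ i, p i * g (Sum.inl i)
    set b := ∑ i, p i * g (Sum.inr i)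
    -- As `D ≤ 1`, pulls also have weight at least `D / 2`; both kinds of information then count
    -- with that weight.
    have h3 : D / 2 * (V / 2) ≤ (1 - D / 2) * a + D / 2 * b := by nlinarith
    have h4 : D ^ 3 ≤ D * (2 * N * V) := by
      have := mul_le_mul_of_nonneg_left hp hD0
      nlinarith
    have hNr : (0 : ℝ) ≤ N := Nat.cast_nonneg N
    have h5 := mul_le_mul_of_nonneg_left h3 hNr
    nlinarith

/-- One step of information-directed sampling: the cubed expected regret is bounded by the
information gain. -/
theorem cube_expRegret_le (hN : 1 ≤ N) {μ : Measure (Params N)} [IsProbabilityMeasure μ]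
    (hμ : ∀ᵐ x ∂μ, IsUnitParams x) (hm : ∀ a, obsMean μ a ∈ Set.Ioo (0 : ℝ) 1) (q : PMF (Act N))
    (hq : ∀ q' : PMF (Act N),
      ENNReal.ofReal
          ((∫ z, (optReward z.1 - reward z.2.1 z.2.2 z.1.2) ∂(stepLaw μ q)) ^ 2) /
        mutualInfo (stepLaw μ q) ≤
      ENNReal.ofReal
          ((∫ z, (optReward z.1 - reward z.2.1 z.2.2 z.1.2) ∂(stepLaw μ q')) ^ 2) /
        mutualInfo (stepLaw μ q')) :
    (∑ a, (q a).toReal * expRegret μ a) ^ 3 ≤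
      128 * N * ∑ a, (q a).toReal * (gain μ a).toReal := by
  have hgt : ∀ a, gain μ a ≠ ∞ := fun a =>
    ((gain_le hμ (hm a)).trans_lt ENNReal.ofReal_lt_top).ne
  set g : Act N → ℝ := fun a => (gain μ a).toReal with hgdef
  have hg : ∀ a, obsVar μ a / 2 ≤ g a := fun a => by
    rw [← ENNReal.ofReal_le_iff_le_toReal (hgt a)]
    exact le_gain hμ (hm a)
  have hg0 : ∀ a, 0 ≤ g a := fun a => ENNReal.toReal_nonneg
  have hI : ∀ q : PMF (Act N), mutualInfo (stepLaw μ q) =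
      ENNReal.ofReal (∑ a, (q a).toReal * g a) := fun q => by
    rw [mutualInfo_stepLaw hμ, ENNReal.ofReal_sum_of_nonneg fun a _ =>
      mul_nonneg ENNReal.toReal_nonneg (hg0 a)]
    refine Finset.sum_congr rfl fun a _ => ?_
    rw [ENNReal.ofReal_mul ENNReal.toReal_nonneg, ENNReal.ofReal_toReal (q.apply_ne_top a),
      ENNReal.ofReal_toReal (hgt a)]
  simp_rw [integral_stepLaw hN hμ, hI] at hq
  obtain ⟨w, D, hw0, hw1, hD0, hwD, hwg⟩ := exists_informative_weights hN hμ hg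
  set d := ∑ a, (q a).toReal * expRegret μ a with hd
  set i := ∑ a, (q a).toReal * g a with hi
  set d' := ∑ a, w a * expRegret μ a with hd'
  set i' := ∑ a, w a * g a with hi'
  have hd0 : 0 ≤ d := Finset.sum_nonneg fun a _ =>
    mul_nonneg ENNReal.toReal_nonneg (expRegret_nonneg μ a)
  have hi0 : 0 ≤ i := Finset.sum_nonneg fun a _ => mul_nonneg ENNReal.toReal_nonneg (hg0 a)
  have hd'0 : 0 ≤ d' := Finset.sum_nonneg fun a _ => mul_nonneg (hw0 a) (expRegret_nonneg μ a)
  have hi'0 : 0 ≤ i' := Finset.sum_nonneg fun a _ => mul_nonneg (hw0 a) (hg0 a)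
  have hNr : (0 : ℝ) < N := by exact_mod_cast hN
  have hseg : ∀ s ∈ Set.Icc (0 : ℝ) 1,
      ENNReal.ofReal (d ^ 2) / ENNReal.ofReal i ≤
        ENNReal.ofReal ((d + s * (d' - d)) ^ 2) / ENNReal.ofReal (i + s * (i' - i)) := by
    intro s hs
    have h0 : ∀ a, 0 ≤ (1 - s) * (q a).toReal + s * w a := fun a =>
      add_nonneg (mul_nonneg (sub_nonneg.2 hs.2) ENNReal.toReal_nonneg) (mul_nonneg hs.1 (hw0 a))
    have h1 : ∑ a, ((1 - s) * (q a).toReal + s * w a) = 1 := by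
      rw [Finset.sum_add_distrib, ← Finset.mul_sum, ← Finset.mul_sum, sum_toReal_pmf, hw1]
      ring
    have h := hq (pmfOfWeights _ h0 h1)
    simp_rw [toReal_pmfOfWeights] at h
    have e : ∀ f : Act N → ℝ, ∑ a, ((1 - s) * (q a).toReal + s * w a) * f a =
        ∑ a, (q a).toReal * f a + s * (∑ a, w a * f a - ∑ a, (q a).toReal * f a) := fun f => by
      rw [← Finset.sum_sub_distrib, Finset.mul_sum, ← Finset.sum_add_distrib]
      exact Finset.sum_congr rfl fun a _ => by ring
    rwa [e, e] at h
  have hfinal := cube_le_of_ratio_minimal (C := 8 * N) hd0 hi0 hd'0 hi'0 hD0 (by positivity) hwD hwg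
    (fun hi00 => ?_) (fun s hs => ?_)
  · linarith
  -- Positive regret without information has ratio `∞`, so minimality makes the competitor's ratio
  -- `∞` too. But if the competitor has no information either, then `D = 0`, its regret vanishes and
  -- its ratio is `0 / 0 = 0`.
  · by_contra hne
    have h := hseg 1 (by norm_num)
    rw [hi00, ENNReal.ofReal_zero, ENNReal.div_zero (by simpa using hne), top_le_iff] at h
    have e1 : d + 1 * (d' - d) = d' := by ring
    have e2 : 0 + 1 * (i' - 0) = i' := by ring
    rw [e1, e2] at h
    rcases hi'0.eq_or_lt with h00 | hpos
    · rw [← h00, mul_zero] at hwg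
      have hDz : D = 0 := by
        by_contra hDne
        have : 0 < D ^ 3 := by positivity
        linarith
      have hd'z : d' = 0 := by linarith
      rw [hd'z] at h
      simp at h
    · exact (ENNReal.div_lt_top ENNReal.ofReal_ne_top (by simpa using hpos)).ne h
  · have h := hseg s hs
    have hi2 : 0 ≤ i + s * (i' - i) := by
      nlinarith [mul_nonneg hs.1 hi'0, mul_nonneg (sub_nonneg.2 hs.2) hi0]
    rcases hi0.eq_or_lt with h00 | hpos
    · rw [← h00] at h ⊢
      by_cases hdz : d = 0
      · simp [hdz]
      · rw [ENNReal.ofReal_zero, ENNReal.div_zero (by simpa using hdz), top_le_iff] at h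
        rw [← h00] at hi2
        rcases hi2.eq_or_lt with h3 | h3
        · rw [← h3]; simp
        · exact absurd h (ENNReal.div_lt_top ENNReal.ofReal_ne_top (by simpa using h3)).ne
    · rcases hi2.eq_or_lt with h3 | h3
      · rw [← h3, mul_zero]; positivity
      · rw [← ENNReal.ofReal_div_of_pos hpos, ← ENNReal.ofReal_div_of_pos h3,
          ENNReal.ofReal_le_ofReal_iff (by positivity), div_le_div_iff₀ hpos h3] at h
        exact h

/-! ### Beta-Bernoulli conjugacy and moments of beta distributions. -/

/-- The likelihood of `s` successes and `f` failures. -/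
def bernoulliLik (s f : ℕ) (u : ℝ) : ℝ≥0∞ := ENNReal.ofReal u ^ s * ENNReal.ofReal (1 - u) ^ f

@[fun_prop]
lemma measurable_bernoulliLik (s f : ℕ) : Measurable (bernoulliLik s f) := by
  unfold bernoulliLik; fun_prop

@[fun_prop]
lemma measurable_betaPDF (a b : ℝ) : Measurable (betaPDF a b) :=
  (measurable_betaPDFReal a b).ennreal_ofReal

/-- Outside `(0, 1)` both densities vanish, so the truncation in `ENNReal.ofReal` plays no role. -/
lemma betaPDF_one_one_mul_bernoulliLik (s f : ℕ) (u : ℝ) :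
    betaPDF 1 1 u * bernoulliLik s f u =
      ENNReal.ofReal (beta (s + 1) (f + 1)) * betaPDF (s + 1) (f + 1) u := by
  by_cases hu : 0 < u ∧ u < 1
  · have hb : 0 < beta ((s : ℝ) + 1) (f + 1) := beta_pos (by positivity) (by positivity)
    have h1 : 0 ≤ 1 - u := by linarith [hu.2]
    have h2 : beta 1 1 = 1 := by
      simp [beta, show (1 : ℝ) + 1 = 2 by norm_num]
    have h3 := hu.1
    rw [betaPDF_of_pos_lt_one hu.1 hu.2, betaPDF_of_pos_lt_one hu.1 hu.2, h2, bernoulliLik,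
      ← ENNReal.ofReal_pow hu.1.le, ← ENNReal.ofReal_pow h1,
      ← ENNReal.ofReal_mul (by positivity), ← ENNReal.ofReal_mul (by simp),
      ← ENNReal.ofReal_mul hb.le]
    congr 1
    simp only [add_sub_cancel_right, sub_self, Real.rpow_natCast, Real.rpow_zero]
    field_simp
  · simp [betaPDF_eq, hu]

/-- The beta distributions are conjugate priors of the Bernoulli distributions. -/
lemma lintegral_bernoulliLik_mul (s f : ℕ) {F : ℝ → ℝ≥0∞} (hF : Measurable F) :
    ∫⁻ u, bernoulliLik s f u * F u ∂(betaMeasure 1 1) =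
      ENNReal.ofReal (beta (s + 1) (f + 1)) * ∫⁻ u, F u ∂(betaMeasure (s + 1) (f + 1)) := by
  unfold betaMeasure
  rw [lintegral_withDensity_eq_lintegral_mul _ (by fun_prop) (by fun_prop),
    lintegral_withDensity_eq_lintegral_mul _ (by fun_prop) hF,
    ← lintegral_const_mul _ (by fun_prop)]
  refine lintegral_congr fun u => ?_
  simp only [Pi.mul_apply]
  rw [← mul_assoc, betaPDF_one_one_mul_bernoulliLik, mul_assoc]

lemma ae_betaMeasure_mem_Ioo (a b : ℝ) : ∀ᵐ u ∂(betaMeasure a b), u ∈ Set.Ioo (0 : ℝ) 1 := by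
  rw [betaMeasure, ae_withDensity_iff (by fun_prop)]
  refine ae_of_all _ fun u hu => ?_
  by_contra h
  exact hu (by rw [betaPDF_eq, if_neg (by simpa using h)]; simp)

lemma beta_add_one {a b : ℝ} (ha : 0 < a) (hb : 0 < b) :
    beta (a + 1) b = beta a b * (a / (a + b)) := by
  have h1 : Real.Gamma (a + b) ≠ 0 := (Real.Gamma_pos_of_pos (by positivity)).ne'
  have h2 : a + b ≠ 0 := by positivity
  rw [beta, beta, Real.Gamma_add_one ha.ne', show a + 1 + b = (a + b) + 1 by ring,
    Real.Gamma_add_one h2]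
  field_simp

/-- The factor `u ^ k` acts as `k` further successes in the likelihood, so moments reduce to
normalizing constants. -/
lemma lintegral_bernoulliLik_beta (s f k : ℕ) :
    ENNReal.ofReal (beta (s + 1) (f + 1)) *
        ∫⁻ u, ENNReal.ofReal u ^ k ∂(betaMeasure (s + 1) (f + 1)) =
      ENNReal.ofReal (beta (s + k + 1) (f + 1)) := by
  have := isProbabilityMeasureBeta (α := (s : ℝ) + k + 1) (β := f + 1) (by positivity)
    (by positivity)
  have h := lintegral_bernoulliLik_mul (s + k) f (F := 1) measurable_one
  rw [← lintegral_bernoulliLik_mul s f (by fun_prop)]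
  simp only [Pi.one_apply, mul_one, lintegral_one, Nat.cast_add, measure_univ] at h
  rw [← h]
  refine lintegral_congr fun u => ?_
  simp only [bernoulliLik]
  ring

lemma integral_pow_betaMeasure (s f k : ℕ) :
    ∫ u, u ^ k ∂(betaMeasure (s + 1) (f + 1)) =
      beta (s + k + 1) (f + 1) / beta (s + 1) (f + 1) := by
  have hb : 0 < beta ((s : ℝ) + 1) (f + 1) := beta_pos (by positivity) (by positivity)
  have hb' : 0 < beta ((s : ℝ) + k + 1) (f + 1) := beta_pos (by positivity) (by positivity)
  rw [integral_eq_lintegral_of_nonneg_ae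
    ((ae_betaMeasure_mem_Ioo _ _).mono fun u hu => pow_nonneg hu.1.le k) (by fun_prop),
    lintegral_congr_ae ((ae_betaMeasure_mem_Ioo _ _).mono fun u hu => ENNReal.ofReal_pow hu.1.le k)]
  have h := congrArg ENNReal.toReal (lintegral_bernoulliLik_beta s f k)
  rw [ENNReal.toReal_mul, ENNReal.toReal_ofReal hb.le, ENNReal.toReal_ofReal hb'.le] at h
  rw [← h]
  field_simp

lemma integral_id_betaMeasure (s f : ℕ) :
    ∫ u, u ∂(betaMeasure (s + 1) (f + 1)) = ((s : ℝ) + 1) / (s + f + 2) := by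
  have hb : beta ((s : ℝ) + 1) (f + 1) ≠ 0 := (beta_pos (by positivity) (by positivity)).ne'
  have h := integral_pow_betaMeasure s f 1
  simp only [pow_one, Nat.cast_one] at h
  rw [h, beta_add_one (by positivity) (by positivity), mul_div_cancel_left₀ _ hb]
  congr 1
  ring

lemma integral_sq_betaMeasure (s f : ℕ) :
    ∫ u, u ^ 2 ∂(betaMeasure (s + 1) (f + 1)) =
      ((s : ℝ) + 1) / (s + f + 2) * ((s + 2) / (s + f + 3)) := by
  have hb : beta ((s : ℝ) + 1) (f + 1) ≠ 0 := (beta_pos (by positivity) (by positivity)).ne'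
  have h := integral_pow_betaMeasure s f 2
  rw [h, show (s : ℝ) + (2 : ℕ) + 1 = (s + 1) + 1 + 1 by push_cast; ring,
    beta_add_one (by positivity) (by positivity), beta_add_one (by positivity) (by positivity),
    mul_assoc, mul_div_cancel_left₀ _ hb]
  congr 2 <;> ring

lemma integral_sub_sq_betaMeasure (s f : ℕ) :
    ∫ u, (u - ((s : ℝ) + 1) / (s + f + 2)) ^ 2 ∂(betaMeasure (s + 1) (f + 1)) =
      ((s : ℝ) + 1) / (s + f + 2) * (1 - ((s : ℝ) + 1) / (s + f + 2)) / (s + f + 3) := by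
  have := isProbabilityMeasureBeta (α := (s : ℝ) + 1) (β := f + 1) (by positivity)
    (by positivity)
  have hae := ae_betaMeasure_mem_Ioo ((s : ℝ) + 1) (f + 1)
  have h1 : Integrable (fun u : ℝ => u) (betaMeasure ((s : ℝ) + 1) (f + 1)) :=
    integrable_of_abs_le (C := 1) measurable_id <| hae.mono fun u hu => by
      rw [abs_of_pos hu.1]; exact hu.2.le
  have h2 : Integrable (fun u : ℝ => u ^ 2) (betaMeasure ((s : ℝ) + 1) (f + 1)) :=
    integrable_of_abs_le (C := 1) (by fun_prop) <| hae.mono fun u hu => by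
      rw [abs_of_nonneg (sq_nonneg u), sq_le_one_iff_abs_le_one, abs_of_pos hu.1]; exact hu.2.le
  have h := integral_mul_sub_sq h1 h2 1 (((s : ℝ) + 1) / (s + f + 2))
  simp only [one_mul, probReal_univ] at h
  rw [h, integral_id_betaMeasure, integral_sq_betaMeasure]
  field_simp
  ring

instance isProbabilityMeasure_prior : IsProbabilityMeasure (prior N) := by
  have := isProbabilityMeasureBeta one_pos one_pos
  unfold prior
  infer_instance

lemma lintegral_prod_pi_betaMeasure {F : Fin N → ℝ → ℝ≥0∞} (hF : ∀ i, Measurable (F i)) :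
    ∫⁻ x, ∏ i, F i (x i) ∂(Measure.pi fun _ : Fin N => betaMeasure 1 1) =
      ∏ i, ∫⁻ u, F i u ∂(betaMeasure 1 1) := by
  have := isProbabilityMeasureBeta one_pos one_pos
  rw [lintegral_prod_eq_prod_lintegral_of_indepFun
    (μ := Measure.pi fun _ : Fin N => betaMeasure 1 1) Finset.univ (fun i x => F i (x i))
    (iIndepFun_pi fun i => (hF i).aemeasurable) fun i => (hF i).comp (measurable_pi_apply i)]
  refine Finset.prod_congr rfl fun i _ => ?_
  exact (measurePreserving_eval (fun _ : Fin N => betaMeasure 1 1) i).lintegral_comp (hF i)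

lemma lintegral_prod_prior {F : Act N → ℝ → ℝ≥0∞} (hF : ∀ a, Measurable (F a)) :
    ∫⁻ x, ∏ a, F a (successProb x a) ∂(prior N) = ∏ a, ∫⁻ u, F a u ∂(betaMeasure 1 1) := by
  have := isProbabilityMeasureBeta one_pos one_pos
  simp only [Fintype.prod_sum_type, successProb, prior]
  rw [lintegral_prod_mul (f := fun x : Fin N → ℝ => ∏ i, F (Sum.inl i) (x i))
    (g := fun x : Fin N → ℝ => ∏ i, F (Sum.inr i) (x i)),
    lintegral_prod_pi_betaMeasure fun i => hF _, lintegral_prod_pi_betaMeasure fun i => hF _]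
  · exact (Finset.measurable_fun_prod _ fun i _ =>
      (hF _).comp (measurable_pi_apply i)).aemeasurable
  · exact (Finset.measurable_fun_prod _ fun i _ =>
      (hF _).comp (measurable_pi_apply i)).aemeasurable

/-! ### The posterior given a history. -/

/-- The number of occurrences of the pair `y` of an action and an observation in a history. -/
def pairCount {t : ℕ} (h : Hist N t) (y : Act N × Bool) : ℕ := ∑ s, if h s = y then 1 else 0

lemma pairCount_succ {t : ℕ} (h : Hist N (t + 1)) (y : Act N × Bool) :
    pairCount h y = pairCount (Fin.init h : Hist N t) y + if h (Fin.last t) = y then 1 else 0 := by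
  rw [pairCount, Fin.sum_univ_castSucc]
  rfl

/-- The agent's choice probabilities do not depend on the parameters and are absorbed in `C`; what
remains depends on the history only through its counts. -/
lemma exists_histProb_eq (π : Agent N) (t : ℕ) (h : Hist N t) :
    ∃ C : ℝ≥0∞, C ≠ ∞ ∧ ∀ x, histProb π x t h =
      C * ∏ a, bernoulliLik (pairCount h (a, true)) (pairCount h (a, false)) (successProb x a) := by
  have key : ∃ C : ℝ≥0∞, C ≠ ∞ ∧ ∀ x, histProb π x t h =
      C * ∏ y : Act N × Bool, obsProb x y.1 y.2 ^ pairCount h y := by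
    induction t with
    | zero => exact ⟨1, ENNReal.one_ne_top, fun x => by simp [histProb, pairCount]⟩
    | succ t ih =>
      obtain ⟨C, hC, hx⟩ := ih (Fin.init h)
      refine ⟨C * π t (Fin.init h) (h (Fin.last t)).1,
        ENNReal.mul_ne_top hC (PMF.apply_ne_top _ _), fun x => ?_⟩
      simp only [histProb, hx, stepProb, pairCount_succ, pow_add, Finset.prod_mul_distrib, pow_ite,
        pow_one, pow_zero, Finset.prod_ite_eq, Finset.mem_univ, if_true]
      ring
  obtain ⟨C, hC, hx⟩ := key
  refine ⟨C, hC, fun x => ?_⟩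
  rw [hx, Fintype.prod_prod_type]
  simp [bernoulliLik, obsProb]

lemma measurable_histProb (π : Agent N) (t : ℕ) (h : Hist N t) :
    Measurable fun x => histProb π x t h := by
  obtain ⟨C, -, hx⟩ := exists_histProb_eq π t h
  simp_rw [hx]
  fun_prop

lemma measurable_histProb_uncurry (π : Agent N) (t : ℕ) :
    Measurable fun z : Params N × Hist N t => histProb π z.1 t z.2 :=
  measurable_from_prod_countable_left fun h => measurable_histProb π t h

lemma jointLaw_apply_prod (π : Agent N) (t : ℕ) (h : Hist N t) {E : Set (Params N)}
    (hE : MeasurableSet E) :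
    jointLaw π t (Prod.snd ⁻¹' {h} ∩ Prod.fst ⁻¹' E) =
      ∫⁻ x in E, histProb π x t h ∂(prior N) := by
  classical
  have hS : MeasurableSet (Prod.snd ⁻¹' {h} ∩ Prod.fst ⁻¹' E : Set (Params N × Hist N t)) :=
    (measurable_snd (measurableSet_singleton h)).inter (measurable_fst hE)
  rw [jointLaw, withDensity_apply _ hS, ← lintegral_indicator hS,
    lintegral_prod_count _ ((measurable_histProb_uncurry π t).indicator hS),
    Finset.sum_eq_single h, ← lintegral_indicator hE]
  · refine lintegral_congr fun x => ?_
    by_cases hx : x ∈ E <;> simp [hx]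
  · intro h' _ hne
    simp [Set.indicator, hne]
  · simp

lemma histLaw_singleton (π : Agent N) (t : ℕ) (h : Hist N t) :
    histLaw π t {h} = ∫⁻ x, histProb π x t h ∂(prior N) := by
  have := jointLaw_apply_prod π t h MeasurableSet.univ
  rw [Set.preimage_univ, Set.inter_univ, setLIntegral_univ] at this
  rw [histLaw, Measure.snd_apply (measurableSet_singleton h), this]

lemma posterior_eq (π : Agent N) {t : ℕ} (h : Hist N t) :
    posterior π h =
      (histLaw π t {h})⁻¹ • (prior N).withDensity fun x => histProb π x t h := by
  ext E hE
  rw [posterior, Measure.fst_apply hE, cond_apply (measurable_snd (measurableSet_singleton h)),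
    jointLaw_apply_prod π t h hE, Measure.smul_apply, withDensity_apply _ hE, smul_eq_mul, histLaw,
    Measure.snd_apply (measurableSet_singleton h)]

lemma exists_lintegral_histProb_mul (π : Agent N) {t : ℕ} (h : Hist N t) :
    ∃ C : ℝ≥0∞, C ≠ ∞ ∧ histLaw π t {h} = C ∧ ∀ (a : Act N) (F : ℝ → ℝ≥0∞), Measurable F →
      ∫⁻ x, histProb π x t h * F (successProb x a) ∂(prior N) =
        C * ∫⁻ u, F u ∂(betaMeasure (pairCount h (a, true) + 1) (pairCount h (a, false) + 1)) := by
  classical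
  obtain ⟨C, hC, hx⟩ := exists_histProb_eq π t h
  set s := fun a => pairCount h (a, true) with hs
  set f := fun a => pairCount h (a, false) with hf
  set B := ∏ a : Act N, ENNReal.ofReal (beta (s a + 1) (f a + 1)) with hB
  have hprob : ∀ a, IsProbabilityMeasure (betaMeasure ((s a : ℝ) + 1) (f a + 1)) := fun a =>
    isProbabilityMeasureBeta (by positivity) (by positivity)
  have key : ∀ G : Act N → ℝ → ℝ≥0∞, (∀ a, Measurable (G a)) →
      ∫⁻ x, histProb π x t h * ∏ a, G a (successProb x a) ∂(prior N) =
        C * B * ∏ a, ∫⁻ u, G a u ∂(betaMeasure (s a + 1) (f a + 1)) := fun G hG => by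
    simp_rw [hx, mul_assoc, ← Finset.prod_mul_distrib]
    rw [lintegral_const_mul _ (Finset.measurable_fun_prod _ fun a _ => by fun_prop),
      lintegral_prod_prior (F := fun a u => bernoulliLik (s a) (f a) u * G a u)
        fun a => (measurable_bernoulliLik _ _).mul (hG a), hB, ← Finset.prod_mul_distrib]
    simp_rw [lintegral_bernoulliLik_mul _ _ (hG _)]
  refine ⟨C * B, ENNReal.mul_ne_top hC (ENNReal.prod_ne_top fun a _ => ENNReal.ofReal_ne_top),
    ?_, fun a F hF => ?_⟩
  · have := key (fun _ _ => 1) fun _ => measurable_const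
    simp only [Finset.prod_const_one, mul_one, lintegral_one, measure_univ] at this
    rw [histLaw_singleton, this]
  -- All factors other than `a` integrate 1 against a probability measure, which isolates the
  -- marginal at `a`.
  · have := key (fun b u => if b = a then F u else 1) fun b => by
      split_ifs
      · exact hF
      · exact measurable_const
    have e : ∀ b, ∫⁻ u, (if b = a then F u else 1) ∂(betaMeasure (s b + 1) (f b + 1)) =
        if b = a then ∫⁻ u, F u ∂(betaMeasure (s b + 1) (f b + 1)) else 1 := fun b => by
      split_ifs <;> simp
    simpa only [e, Finset.prod_ite_eq', Finset.mem_univ, if_true] using this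

lemma histLaw_singleton_ne_top (π : Agent N) {t : ℕ} (h : Hist N t) : histLaw π t {h} ≠ ∞ := by
  obtain ⟨C, hC, h1, -⟩ := exists_lintegral_histProb_mul π h
  rwa [h1]

/-- Under the posterior, the success probability of an action has a beta distribution. -/
theorem map_successProb_posterior (π : Agent N) {t : ℕ} {h : Hist N t}
    (hh : histLaw π t {h} ≠ 0) (a : Act N) :
    (posterior π h).map (fun x => successProb x a) =
      betaMeasure (pairCount h (a, true) + 1) (pairCount h (a, false) + 1) := by
  obtain ⟨C, hC, h1, h2⟩ := exists_lintegral_histProb_mul π h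
  ext E hE
  have h3 := h2 a (E.indicator 1) (measurable_one.indicator hE)
  rw [lintegral_indicator_one hE] at h3
  have hm : Measurable fun x : Params N => successProb x a := measurable_successProb a
  rw [← lintegral_indicator_one hE, lintegral_map (measurable_one.indicator hE) hm, posterior_eq,
    lintegral_smul_measure, lintegral_withDensity_eq_lintegral_mul _ (measurable_histProb π t h)
      (g := fun x => E.indicator 1 (successProb x a)) ((measurable_one.indicator hE).comp hm)]
  simp only [Pi.mul_apply]
  rw [h3, h1, smul_eq_mul, ← mul_assoc, ENNReal.inv_mul_cancel (h1 ▸ hh) hC, one_mul]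

lemma isProbabilityMeasure_posterior (hN : 1 ≤ N) (π : Agent N) {t : ℕ} {h : Hist N t}
    (hh : histLaw π t {h} ≠ 0) : IsProbabilityMeasure (posterior π h) := by
  have a : Act N := Sum.inl ⟨0, hN⟩
  have h1 := map_successProb_posterior π hh a
  have h2 := isProbabilityMeasureBeta (α := (pairCount h (a, true) : ℝ) + 1)
    (β := pairCount h (a, false) + 1) (by positivity) (by positivity)
  rw [← h1] at h2
  exact (Measure.isProbabilityMeasure_map_iff (measurable_successProb a).aemeasurable).1 h2

lemma ae_isUnitParams_prior : ∀ᵐ x ∂(prior N), IsUnitParams x := by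
  classical
  unfold IsUnitParams
  rw [ae_all_iff]
  intro a
  have h := lintegral_prod_prior (N := N)
    (F := fun b u => if b = a then (Set.Icc (0 : ℝ) 1)ᶜ.indicator 1 u else 1) fun b => by
      split_ifs
      · exact measurable_one.indicator measurableSet_Icc.compl
      · exact measurable_const
  simp only [Finset.prod_ite_eq', Finset.mem_univ, if_true] at h
  have hm : MeasurableSet {x : Params N | successProb x a ∈ (Set.Icc (0 : ℝ) 1)ᶜ} :=
    measurable_successProb a measurableSet_Icc.compl
  have h1 : prior N {x | successProb x a ∈ (Set.Icc (0 : ℝ) 1)ᶜ} = 0 := by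
    rw [← lintegral_indicator_one hm]
    refine h.trans (Finset.prod_eq_zero (Finset.mem_univ a) ?_)
    simp only [if_true]
    rw [lintegral_indicator_one measurableSet_Icc.compl]
    exact (ae_betaMeasure_mem_Ioo 1 1).mono fun u hu => ⟨hu.1.le, hu.2.le⟩
  exact h1

lemma ae_isUnitParams_posterior (π : Agent N) {t : ℕ} (h : Hist N t) :
    ∀ᵐ x ∂(posterior π h), IsUnitParams x := by
  rw [posterior_eq]
  exact Measure.ae_smul_measure ((withDensity_absolutelyContinuous _ _).ae_le
    ae_isUnitParams_prior) _

/-- The number of times an action occurs in a history. -/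
def actCount {t : ℕ} (h : Hist N t) (a : Act N) : ℕ :=
  pairCount h (a, true) + pairCount h (a, false)

lemma obsMean_posterior (π : Agent N) {t : ℕ} {h : Hist N t}
    (hh : histLaw π t {h} ≠ 0) (a : Act N) :
    obsMean (posterior π h) a = (pairCount h (a, true) + 1) / (actCount h a + 2) := by
  rw [obsMean, ← integral_map (f := fun u => u) (measurable_successProb a).aemeasurable
    (by fun_prop), map_successProb_posterior π hh, integral_id_betaMeasure, actCount, Nat.cast_add]

lemma obsMean_posterior_mem (π : Agent N) {t : ℕ} {h : Hist N t}
    (hh : histLaw π t {h} ≠ 0) (a : Act N) :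
    obsMean (posterior π h) a ∈ Set.Ioo (0 : ℝ) 1 := by
  rw [obsMean_posterior π hh, actCount, Nat.cast_add]
  refine ⟨by positivity, ?_⟩
  rw [div_lt_one (by positivity)]
  have : (0 : ℝ) ≤ pairCount h (a, false) := by positivity
  linarith

lemma obsVar_posterior (π : Agent N) {t : ℕ} {h : Hist N t}
    (hh : histLaw π t {h} ≠ 0) (a : Act N) :
    obsVar (posterior π h) a = obsMean (posterior π h) a * (1 - obsMean (posterior π h) a) /
      (actCount h a + 3) := by
  rw [obsVar, ← integral_map (f := fun u => (u - obsMean (posterior π h) a) ^ 2)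
    (measurable_successProb a).aemeasurable (by fun_prop), map_successProb_posterior π hh,
    obsMean_posterior π hh, actCount, Nat.cast_add, integral_sub_sq_betaMeasure]

/-- After `n` observations of an action, one more carries at most `1 / (n + 3)` nats. -/
theorem toReal_gain_posterior_le (hN : 1 ≤ N) (π : Agent N) {t : ℕ} {h : Hist N t}
    (hh : histLaw π t {h} ≠ 0) (a : Act N) :
    (gain (posterior π h) a).toReal ≤ 1 / (actCount h a + 3) := by
  have := isProbabilityMeasure_posterior hN π hh
  have hm := obsMean_posterior_mem π hh a
  refine ENNReal.toReal_le_of_le_ofReal (by positivity)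
    ((gain_le (ae_isUnitParams_posterior π h) hm).trans_eq ?_)
  have h1 : obsMean (posterior π h) a * (1 - obsMean (posterior π h) a) ≠ 0 :=
    (mul_pos hm.1 (sub_pos.2 hm.2)).ne'
  rw [obsVar_posterior π hh, div_right_comm, div_self h1]

/-! ### Averaging over histories. -/

lemma sum_hist_succ {M : Type*} [AddCommMonoid M] (t : ℕ) (G : Hist N t → Act N × Bool → M) :
    ∑ h : Hist N (t + 1), G (Fin.init h) (h (Fin.last t)) = ∑ h, ∑ y, G h y := by
  rw [← Equiv.sum_comp (Fin.snocEquiv fun _ => Act N × Bool), Fintype.sum_prod_type,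
    Finset.sum_comm]
  refine Finset.sum_congr rfl fun h _ => Finset.sum_congr rfl fun y _ => ?_
  simp [Fin.snocEquiv]

lemma histProb_ne_top (π : Agent N) (x : Params N) (t : ℕ) (h : Hist N t) :
    histProb π x t h ≠ ∞ := by
  induction t with
  | zero => exact ENNReal.one_ne_top
  | succ t ih => exact ENNReal.mul_ne_top (ih _) (stepProb_ne_top _ _ _)

lemma toReal_histProb_le_one (π : Agent N) {x : Params N} (hx : IsUnitParams x) (t : ℕ)
    (h : Hist N t) : (histProb π x t h).toReal ≤ 1 := by
  induction t with
  | zero => simp [histProb]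
  | succ t ih =>
    rw [histProb, stepProb, ENNReal.toReal_mul, ENNReal.toReal_mul]
    have hq : (π t (Fin.init h) (h (Fin.last t)).1).toReal ≤ 1 := by
      simpa using ENNReal.toReal_mono ENNReal.one_ne_top
        (PMF.coe_le_one (π t (Fin.init h)) (h (Fin.last t)).1)
    exact mul_le_one₀ (ih _) (mul_nonneg ENNReal.toReal_nonneg ENNReal.toReal_nonneg)
      (mul_le_one₀ hq ENNReal.toReal_nonneg (toReal_obsProb_mem hx _ _).2)

/-- The probability of a history, as a real number. -/
def histWeight (π : Agent N) {t : ℕ} (h : Hist N t) : ℝ := (histLaw π t {h}).toReal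

lemma histWeight_nonneg (π : Agent N) {t : ℕ} (h : Hist N t) : 0 ≤ histWeight π h :=
  ENNReal.toReal_nonneg

/-- Bayes' rule. Histories of probability zero are included, since their likelihood vanishes almost
everywhere. -/
lemma integral_histProb_mul (π : Agent N) {t : ℕ} (h : Hist N t) (G : Params N → ℝ) :
    ∫ x, (histProb π x t h).toReal * G x ∂(prior N) =
      histWeight π h * ∫ x, G x ∂(posterior π h) := by
  by_cases h0 : histLaw π t {h} = 0
  · rw [histWeight, h0, ENNReal.toReal_zero, zero_mul]
    rw [histLaw_singleton, lintegral_eq_zero_iff (measurable_histProb π t h)] at h0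
    refine integral_eq_zero_of_ae (h0.mono fun x hx => ?_)
    simp only [Pi.zero_apply] at hx ⊢
    rw [hx, ENNReal.toReal_zero, zero_mul]
  · rw [posterior_eq, integral_smul_measure, integral_withDensity_eq_integral_toReal_smul
      (measurable_histProb π t h) (ae_of_all _ fun x => (histProb_ne_top π x t h).lt_top),
      smul_eq_mul, ← mul_assoc, ENNReal.toReal_inv, histWeight,
      mul_inv_cancel₀ (ENNReal.toReal_ne_zero.2 ⟨h0, histLaw_singleton_ne_top π h⟩), one_mul]
    rfl

/-- The expected regret of the action at time `t`, split according to the history. -/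
lemma integral_jointLaw_succ (hN : 1 ≤ N) (π : Agent N) (t : ℕ) :
    ∫ p, (optReward p.1 - reward (p.2 (Fin.last t)).1 (p.2 (Fin.last t)).2 p.1.2)
      ∂(jointLaw π (t + 1)) =
    ∑ h : Hist N t, histWeight π h *
      ∑ a, (π t h a).toReal * expRegret (posterior π h) a := by
  have hmeas : Measurable fun p : Params N × Hist N (t + 1) =>
      optReward p.1 - reward (p.2 (Fin.last t)).1 (p.2 (Fin.last t)).2 p.1.2 :=
    measurable_from_prod_countable_left fun h => by
      exact measurable_optReward.sub (measurable_reward_snd (h (Fin.last t)).1 (h (Fin.last t)).2)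
  rw [jointLaw, integral_withDensity_prod_count (prior N) (measurable_histProb_uncurry π (t + 1))
    (fun z => histProb_ne_top π _ _ _) (fun h => ?_) hmeas]
  · have h1 : ∀ h : Hist N (t + 1), ∫ x, (histProb π x (t + 1) h).toReal *
        (optReward x - reward (h (Fin.last t)).1 (h (Fin.last t)).2 x.2) ∂(prior N) =
        histWeight π (Fin.init h : Hist N t) *
          ∫ x, (stepProb (π t (Fin.init h)) x (h (Fin.last t))).toReal *
            (optReward x - reward (h (Fin.last t)).1 (h (Fin.last t)).2 x.2)
              ∂(posterior π (Fin.init h : Hist N t)) := fun h => by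
      simp only [histProb, ENNReal.toReal_mul, mul_assoc]
      exact integral_histProb_mul π _ _
    simp only [h1]
    rw [sum_hist_succ t fun h y => histWeight π h * ∫ x, (stepProb (π t h) x y).toReal *
      (optReward x - reward y.1 y.2 x.2) ∂(posterior π h)]
    refine Finset.sum_congr rfl fun h _ => ?_
    rw [← Finset.mul_sum]
    by_cases h0 : histLaw π t {h} = 0
    · simp [histWeight, h0]
    · have := isProbabilityMeasure_posterior hN π h0
      rw [sum_integral_stepProb_mul hN (ae_isUnitParams_posterior π h)]
  · have hm := measurable_histProb π (t + 1) h
    refine integrable_of_abs_le (C := 2) (hm.ennreal_toReal.mul (measurable_optReward.sub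
      (measurable_reward_snd (h (Fin.last t)).1 (h (Fin.last t)).2)))
      (ae_isUnitParams_prior.mono fun x hx => ?_)
    have h1 := toReal_histProb_le_one π hx (t + 1) h
    have h2 := abs_optReward_sub_reward_le hN hx (h (Fin.last t)).1 (h (Fin.last t)).2
    rw [abs_mul, abs_of_nonneg ENNReal.toReal_nonneg]
    nlinarith [abs_nonneg (optReward x - reward (h (Fin.last t)).1 (h (Fin.last t)).2 x.2),
      ENNReal.toReal_nonneg (a := histProb π x (t + 1) h)]

/-- The tower property: the last observation is summed out and the last action is averaged with `π t
h`. It drives the induction for the information budget. -/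
lemma sum_histWeight_succ (π : Agent N) (t : ℕ) (G : Hist N t → Act N → ℝ) :
    ∑ h : Hist N (t + 1), histWeight π h * G (Fin.init h) (h (Fin.last t)).1 =
      ∑ h, histWeight π h * ∑ a, (π t h a).toReal * G h a := by
  have h1 : ∀ h : Hist N (t + 1), histWeight π h =
      ∫ x, (histProb π x t (Fin.init h)).toReal *
        (stepProb (π t (Fin.init h)) x (h (Fin.last t))).toReal ∂(prior N) := fun h => by
    rw [histWeight, histLaw_singleton, ← integral_toReal
      (measurable_histProb π (t + 1) h).aemeasurable
      (ae_of_all _ fun x => (histProb_ne_top π x (t + 1) h).lt_top)]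
    simp only [histProb, ENNReal.toReal_mul]
  simp only [h1]
  rw [sum_hist_succ t fun h y => (∫ x, (histProb π x t h).toReal *
    (stepProb (π t h) x y).toReal ∂(prior N)) * G h y.1]
  refine Finset.sum_congr rfl fun h _ => ?_
  rw [Fintype.sum_prod_type, Finset.mul_sum]
  refine Finset.sum_congr rfl fun a _ => ?_
  simp only
  rw [← Finset.sum_mul, ← mul_assoc]
  congr 1
  have hm := measurable_histProb π t h
  have hint : ∀ o ∈ Finset.univ, Integrable (fun x => (histProb π x t h).toReal *
      (stepProb (π t h) x (a, o)).toReal) (prior N) := fun o _ => by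
    simp only [stepProb]
    refine integrable_of_abs_le (C := 1) (by fun_prop) (ae_isUnitParams_prior.mono fun x hx => ?_)
    have hq : (π t h a).toReal ≤ 1 := by
      simpa using ENNReal.toReal_mono ENNReal.one_ne_top (PMF.coe_le_one (π t h) a)
    rw [ENNReal.toReal_mul, abs_of_nonneg (by positivity)]
    exact mul_le_one₀ (toReal_histProb_le_one π hx t h) (by positivity)
      (mul_le_one₀ hq ENNReal.toReal_nonneg (toReal_obsProb_mem hx _ _).2)
  rw [← integral_finsetSum _ hint, histWeight, histLaw_singleton, ← integral_toReal
    hm.aemeasurable (ae_of_all _ fun x => (histProb_ne_top π x t h).lt_top), ← integral_mul_const]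
  refine integral_congr_ae (ae_isUnitParams_prior.mono fun x hx => ?_)
  have h := congrArg ENNReal.toReal (sum_obsProb hx a)
  rw [ENNReal.toReal_sum fun o _ => obsProb_ne_top x a o, ENNReal.toReal_one] at h
  simp only [stepProb, ENNReal.toReal_mul, ← Finset.mul_sum, h, mul_one]

lemma sum_histWeight (π : Agent N) (t : ℕ) : ∑ h : Hist N t, histWeight π h = 1 := by
  induction t with
  | zero =>
    rw [Fintype.sum_unique, histWeight, histLaw_singleton]
    simp [histProb]
  | succ t ih =>
    have := sum_histWeight_succ π t fun _ _ => 1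
    simp only [mul_one, sum_toReal_pmf, ih] at this
    exact this

/-! ### The total information budget. -/

lemma actCount_succ {t : ℕ} (h : Hist N (t + 1)) (a : Act N) :
    actCount h a =
      actCount (Fin.init h : Hist N t) a + if (h (Fin.last t)).1 = a then 1 else 0 := by
  rw [actCount, actCount, pairCount_succ, pairCount_succ]
  rcases h (Fin.last t) with ⟨b, o⟩
  cases o <;> simp only [Prod.mk.injEq, and_true, and_false, Bool.false_eq_true, if_false,
    reduceCtorEq] <;> omega

lemma actCount_le {t : ℕ} (h : Hist N t) (a : Act N) : actCount h a ≤ t := by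
  induction t with
  | zero => simp [actCount, pairCount]
  | succ t ih =>
    rw [actCount_succ]
    have := ih (Fin.init h)
    split_ifs <;> omega

/-- The pathwise bound on the information accumulated along a history. -/
def infoPotential {t : ℕ} (h : Hist N t) : ℝ :=
  ∑ a, ∑ k ∈ Finset.range (actCount h a), 1 / ((k : ℝ) + 3)

lemma infoPotential_succ {t : ℕ} (h : Hist N (t + 1)) :
    infoPotential h = infoPotential (Fin.init h : Hist N t) +
      1 / (actCount (Fin.init h : Hist N t) (h (Fin.last t)).1 + 3) := by
  have : ∀ a, ∑ k ∈ Finset.range (actCount h a), 1 / ((k : ℝ) + 3) =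
      ∑ k ∈ Finset.range (actCount (Fin.init h : Hist N t) a), 1 / ((k : ℝ) + 3) +
        if (h (Fin.last t)).1 = a then 1 / ((actCount (Fin.init h : Hist N t) a : ℝ) + 3)
          else 0 := fun a => by
    rw [actCount_succ]
    split_ifs
    · rw [Finset.sum_range_succ]
    · rw [add_zero, add_zero]
  simp only [infoPotential, this]
  rw [Finset.sum_add_distrib, Finset.sum_ite_eq, if_pos (Finset.mem_univ _)]

/-- No action occurs more than `t` times, so each of the `2 * N` inner sums is below a harmonic
number. -/
lemma infoPotential_le {t : ℕ} (h : Hist N t) :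
    infoPotential h ≤ 2 * N * (1 + Real.log t) := by
  have h1 : ∀ a, ∑ k ∈ Finset.range (actCount h a), 1 / ((k : ℝ) + 3) ≤ 1 + Real.log t :=
    fun a => by
      have h2 := harmonic_le_one_add_log t
      rw [harmonic] at h2
      push_cast at h2
      refine le_trans ?_ h2
      refine (Finset.sum_le_sum_of_subset_of_nonneg (Finset.range_mono (actCount_le h a))
        fun k _ _ => by positivity).trans (Finset.sum_le_sum fun k _ => ?_)
      rw [one_div]
      exact inv_anti₀ (by positivity) (by linarith)
  refine (Finset.sum_le_sum fun a _ => h1 a).trans_eq ?_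
  rw [Finset.sum_const, Finset.card_univ, Fintype.card_sum, Fintype.card_fin, nsmul_eq_mul]
  push_cast
  ring

/-- The information available to any agent in `T` steps is of order `N log T`. -/
theorem sum_info_le (π : Agent N) (T : ℕ) :
    ∑ t ∈ Finset.range T, ∑ h : Hist N t, histWeight π h *
      ∑ a, (π t h a).toReal * (1 / ((actCount h a : ℝ) + 3)) ≤ 2 * N * (1 + Real.log T) := by
  have key : ∑ t ∈ Finset.range T, ∑ h : Hist N t, histWeight π h *
      ∑ a, (π t h a).toReal * (1 / ((actCount h a : ℝ) + 3)) =
      ∑ h : Hist N T, histWeight π h * infoPotential h := by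
    induction T with
    | zero => simp [infoPotential, actCount, pairCount]
    | succ T ih =>
      rw [Finset.sum_range_succ, ih]
      simp only [infoPotential_succ]
      rw [sum_histWeight_succ π T fun h a => infoPotential h + 1 / ((actCount h a : ℝ) + 3),
        ← Finset.sum_add_distrib]
      refine Finset.sum_congr rfl fun h _ => ?_
      -- The expected increment of the potential in one step is exactly the summand at time `T`.
      simp only [mul_add, Finset.sum_add_distrib, ← Finset.sum_mul, sum_toReal_pmf, one_mul]
  rw [key]
  calc _ ≤ ∑ h : Hist N T, histWeight π h * (2 * N * (1 + Real.log T)) :=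
        Finset.sum_le_sum fun h _ =>
          mul_le_mul_of_nonneg_left (infoPotential_le h) (histWeight_nonneg π h)
    _ = _ := by rw [← Finset.sum_mul, sum_histWeight, one_mul]

/-! ### Summation to the regret bound. -/

/-- The regret of information-directed sampling at one history, linearized at level `c`. -/
lemma IsIDS.regret_step_le (hN : 1 ≤ N) {π : Agent N} (hπ : IsIDS π) {t : ℕ} (h : Hist N t)
    {c : ℝ} (hc : 0 < c) :
    histWeight π h * ∑ a, (π t h a).toReal * expRegret (posterior π h) a ≤
      128 * N / (3 * c ^ 2) * (histWeight π h *
        ∑ a, (π t h a).toReal * (1 / ((actCount h a : ℝ) + 3))) +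
      2 * c / 3 * histWeight π h := by
  by_cases h0 : histLaw π t {h} = 0
  · simp [histWeight, h0]
  have := isProbabilityMeasure_posterior hN π h0
  have h1 := cube_expRegret_le hN (ae_isUnitParams_posterior π h) (obsMean_posterior_mem π h0)
    (π t h) (hπ t h h0)
  have h2 : ∑ a, (π t h a).toReal * (gain (posterior π h) a).toReal ≤
      ∑ a, (π t h a).toReal * (1 / ((actCount h a : ℝ) + 3)) :=
    Finset.sum_le_sum fun a _ => mul_le_mul_of_nonneg_left
      (toReal_gain_posterior_le hN π h0 a) ENNReal.toReal_nonneg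
  set d := ∑ a, (π t h a).toReal * expRegret (posterior π h) a
  set J := ∑ a, (π t h a).toReal * (1 / ((actCount h a : ℝ) + 3))
  have hd : 0 ≤ d := Finset.sum_nonneg fun a _ =>
    mul_nonneg ENNReal.toReal_nonneg (expRegret_nonneg _ a)
  have h3 : d ^ 3 ≤ 128 * N * J :=
    h1.trans (mul_le_mul_of_nonneg_left h2 (by positivity))
  have h4 : d ≤ 128 * N / (3 * c ^ 2) * J + 2 * c / 3 := by
    have e : 128 * N / (3 * c ^ 2) * J + 2 * c / 3 =
        (128 * N * J + 2 * c ^ 3) / (3 * c ^ 2) := by field_simp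
    rw [e, le_div_iff₀ (by positivity)]
    -- The identity `(d - c) ^ 2 * (d + 2 * c) = d ^ 3 - 3 * c ^ 2 * d + 2 * c ^ 3` is the tangent
    -- line bound for the cube at `c`.
    nlinarith [mul_nonneg (sq_nonneg (d - c)) (by positivity : 0 ≤ d + 2 * c)]
  have := mul_le_mul_of_nonneg_left h4 (histWeight_nonneg π h)
  linarith

theorem IsIDS.regret_le_of_pos (hN : 1 ≤ N) {π : Agent N} (hπ : IsIDS π) (T : ℕ) {c : ℝ}
    (hc : 0 < c) :
    regret π T ≤ 128 * N / (3 * c ^ 2) * (2 * N * (1 + Real.log T)) + 2 * c / 3 * T := by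
  have h1 : regret π T ≤ ∑ t ∈ Finset.range T, (128 * N / (3 * c ^ 2) *
      (∑ h : Hist N t, histWeight π h *
        ∑ a, (π t h a).toReal * (1 / ((actCount h a : ℝ) + 3))) + 2 * c / 3) := by
    refine Finset.sum_le_sum fun t _ => ?_
    rw [integral_jointLaw_succ hN]
    refine (Finset.sum_le_sum fun h _ => hπ.regret_step_le hN h hc).trans_eq ?_
    rw [Finset.sum_add_distrib, ← Finset.mul_sum, ← Finset.mul_sum, sum_histWeight, mul_one]
  refine h1.trans ?_
  rw [Finset.sum_add_distrib, ← Finset.mul_sum, Finset.sum_const, Finset.card_range, nsmul_eq_mul,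
    mul_comm (T : ℝ)]
  gcongr
  exact sum_info_le π T

/-- This is `e ≤ 4`, in the form `1 ≤ 2 log 2`. -/
lemma one_add_log_le_log_four_mul {T : ℝ} (hT : 0 < T) :
    1 + Real.log T ≤ Real.log (4 * T) := by
  rw [Real.log_mul (by norm_num) hT.ne', show (4 : ℝ) = 2 ^ 2 by norm_num, Real.log_pow]
  push_cast
  linarith [Real.log_two_gt_d9]

theorem IsIDS.regret_le (hN : 1 ≤ N) {π : Agent N} (hπ : IsIDS π) (T : ℕ) :
    regret π T ≤ Real.sqrt (33 * Real.log (4 * (T : ℝ))) *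
      (Fintype.card (Act N) : ℝ) ^ (3 / 4 : ℝ) * (T : ℝ) ^ (3 / 4 : ℝ) := by
  rcases Nat.eq_zero_or_pos T with rfl | hT
  · simp [regret]
  have hTr : (1 : ℝ) ≤ T := by exact_mod_cast hT
  have hNr : (1 : ℝ) ≤ N := by exact_mod_cast hN
  have hcard : (Fintype.card (Act N) : ℝ) = 2 * N := by
    rw [Fintype.card_sum, Fintype.card_fin]
    push_cast
    ring
  have hlog := one_add_log_le_log_four_mul (zero_lt_one.trans_le hTr)
  have hlog1 : 1 ≤ Real.log (4 * (T : ℝ)) := by linarith [Real.log_nonneg hTr]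
  rw [hcard]
  have hroot : ∀ y : ℝ, 0 < y → ∃ b : ℝ, 0 < b ∧ y = b ^ 4 ∧ y ^ (3 / 4 : ℝ) = b ^ 3 :=
    fun y hy => by
      refine ⟨y ^ (1 / 4 : ℝ), by positivity, ?_, ?_⟩
      · rw [← Real.rpow_natCast, ← Real.rpow_mul hy.le]; norm_num
      · rw [← Real.rpow_natCast, ← Real.rpow_mul hy.le]; norm_num
  obtain ⟨a, ha, haN, ha3⟩ := hroot (2 * N) (by linarith)
  obtain ⟨τ, hτ, hτT, hτ3⟩ := hroot T (by linarith)
  rw [ha3, hτ3]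
  set l := Real.log (4 * (T : ℝ)) with hl
  set r := Real.sqrt (33 * l) with hr
  have hr2 : r ^ 2 = 33 * l := Real.sq_sqrt (by linarith)
  have hr5 : 5 ≤ r := Real.le_sqrt_of_sq_le (by linarith)
  have hτ1 : 1 ≤ τ := by
    by_contra hcon
    have := pow_lt_one₀ hτ.le (not_le.1 hcon) (by norm_num : 4 ≠ 0)
    linarith
  have ha1 : 1 ≤ a := by
    by_contra hcon
    have := pow_lt_one₀ ha.le (not_le.1 hcon) (by norm_num : 4 ≠ 0)
    linarith
  -- This level makes the term linear in `c` exactly two thirds of the target. The information term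
  -- has to fit in the remaining third, which amounts to `64 * (1 + log T) ≤ 33 * l * r * a * τ`;
  -- this follows from `r ≥ 5` and `a * τ ≥ 1`.
  have hc : 0 < r * a ^ 3 / τ := by positivity
  refine (hπ.regret_le_of_pos hN T hc).trans ?_
  have e1 : 2 * (r * a ^ 3 / τ) / 3 * T = 2 / 3 * (r * a ^ 3 * τ ^ 3) := by
    rw [hτT]; field_simp
  have e2 : 128 * N / (3 * (r * a ^ 3 / τ) ^ 2) * (2 * N * (1 + Real.log T)) ≤
      1 / 3 * (r * a ^ 3 * τ ^ 3) := by
    have e3 : 128 * N / (3 * (r * a ^ 3 / τ) ^ 2) * (2 * N * (1 + Real.log T)) =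
        64 * (2 * N) ^ 2 * τ ^ 2 * (1 + Real.log T) / (3 * r ^ 2 * a ^ 6) := by
      field_simp
      ring
    rw [e3, haN, div_le_iff₀ (by positivity)]
    have e4 : 1 / 3 * (r * a ^ 3 * τ ^ 3) * (3 * r ^ 2 * a ^ 6) =
        (33 * l) * r * (a * τ) * (a ^ 8 * τ ^ 2) := by rw [← hr2]; ring
    have e5 : 64 * (a ^ 4) ^ 2 * τ ^ 2 * (1 + Real.log T) =
        64 * (1 + Real.log T) * (a ^ 8 * τ ^ 2) := by ring
    rw [e4, e5]
    refine mul_le_mul_of_nonneg_right ?_ (by positivity)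
    have h6 : 1 ≤ a * τ := one_le_mul_of_one_le_of_one_le ha1 hτ1
    have h7 : 5 ≤ r * (a * τ) := by nlinarith
    have h8 : 33 * l * 5 ≤ 33 * l * (r * (a * τ)) :=
      mul_le_mul_of_nonneg_left h7 (by linarith)
    linarith
  rw [e1]
  linarith

/-! ### Sublinearity of the bound. -/

lemma isLittleO_natCast_rpow {s : ℝ} (hs : s < 1) :
    (fun n : ℕ => (n : ℝ) ^ s) =o[Filter.atTop] fun n : ℕ => (n : ℝ) := by
  have h : (fun x : ℝ => x ^ s) =o[Filter.atTop] fun x : ℝ => x := by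
    rw [isLittleO_iff_tendsto' ((Filter.eventually_gt_atTop 0).mono fun x hx h => absurd h hx.ne')]
    refine (tendsto_rpow_neg_atTop (sub_pos.2 hs)).congr' ?_
    filter_upwards [Filter.eventually_gt_atTop 0] with x hx
    rw [neg_sub, Real.rpow_sub_one hx.ne']
  exact h.comp_tendsto tendsto_natCast_atTop_atTop

/-- From `log x ≤ 4 * x ^ (1/4)`, whence `132 = 33 * 4`. The exponent `1/8` is small enough that
`1/8 + 3/4 < 1`. -/
lemma sqrt_log_mul_le (T : ℕ) :
    Real.sqrt (33 * Real.log (4 * (T : ℝ))) ≤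
      Real.sqrt 132 * 4 ^ (1 / 8 : ℝ) * (T : ℝ) ^ (1 / 8 : ℝ) := by
  have hT : (0 : ℝ) ≤ T := Nat.cast_nonneg T
  have h := Real.log_le_rpow_div (by positivity : (0 : ℝ) ≤ 4 * T) (by norm_num : (0 : ℝ) < 1 / 4)
  refine (Real.sqrt_le_sqrt (by linarith : _ ≤ 132 * (4 * (T : ℝ)) ^ (1 / 4 : ℝ))).trans_eq ?_
  rw [Real.sqrt_mul (by norm_num), Real.sqrt_eq_rpow ((4 * (T : ℝ)) ^ (1 / 4 : ℝ)),
    ← Real.rpow_mul (by positivity), mul_assoc, ← Real.mul_rpow (by norm_num) hT]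
  norm_num

end BanditAlignment

end

theorem mainTheorem1 (N : ℕ) (hN : 1 ≤ N) (π : BanditAlignment.Agent N)
    (hπ : BanditAlignment.IsIDS π) :
    (∀ T : ℕ, BanditAlignment.regret π T ≤
      Real.sqrt (33 * Real.log (4 * (T : ℝ))) *
        (Fintype.card (BanditAlignment.Act N) : ℝ) ^ (3 / 4 : ℝ) * (T : ℝ) ^ (3 / 4 : ℝ)) ∧
    (∀ m : ℕ,
      (fun T : ℕ => Real.sqrt (33 * Real.log (4 * (T : ℝ))) * (m : ℝ) ^ (3 / 4 : ℝ) *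
        (T : ℝ) ^ (3 / 4 : ℝ)) =o[Filter.atTop] (fun T : ℕ => (T : ℝ))) ∧
    (∀ T : ℕ,
      (fun m : ℕ => Real.sqrt (33 * Real.log (4 * (T : ℝ))) * (m : ℝ) ^ (3 / 4 : ℝ) *
        (T : ℝ) ^ (3 / 4 : ℝ)) =o[Filter.atTop] (fun m : ℕ => (m : ℝ))) := by
  refine ⟨fun T => hπ.regret_le hN T, fun m => ?_, fun T => ?_⟩
  · refine IsBigO.trans_isLittleO (g := fun T : ℕ => (T : ℝ) ^ (7 / 8 : ℝ))
      (IsBigO.of_bound (Real.sqrt 132 * 4 ^ (1 / 8 : ℝ) * (m : ℝ) ^ (3 / 4 : ℝ))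
        (Filter.Eventually.of_forall fun T => ?_))
      (BanditAlignment.isLittleO_natCast_rpow (by norm_num))
    rw [Real.norm_of_nonneg (by positivity), Real.norm_of_nonneg (by positivity)]
    have e : (T : ℝ) ^ (7 / 8 : ℝ) = (T : ℝ) ^ (1 / 8 : ℝ) * (T : ℝ) ^ (3 / 4 : ℝ) := by
      rw [← Real.rpow_add_of_nonneg (Nat.cast_nonneg T) (by norm_num) (by norm_num)]
      norm_num
    calc _ ≤ Real.sqrt 132 * 4 ^ (1 / 8 : ℝ) * (T : ℝ) ^ (1 / 8 : ℝ) * (m : ℝ) ^ (3 / 4 : ℝ) *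
          (T : ℝ) ^ (3 / 4 : ℝ) := by
          gcongr
          exact BanditAlignment.sqrt_log_mul_le T
      _ = _ := by rw [e]; ring
  · have h := (BanditAlignment.isLittleO_natCast_rpow (s := 3 / 4) (by norm_num)).const_mul_left
      (Real.sqrt (33 * Real.log (4 * (T : ℝ))) * (T : ℝ) ^ (3 / 4 : ℝ))
    exact h.congr_left fun m => by ring
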